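/- **Definitions.** For a metric space $(X,d)$ and $f:X\to\mathbb R$ put $|\nabla f|(x)=\limsup_{y\to x,\,y\neq x}|f(y)-f(x)|/d(x,y)$. A Borel probability measure $\mu$ on $X$ satisfies $LSI(\alpha)$, $\alpha>0$, if $$\int_X f^2\log\Bigl(f^2\Big/\int_X f^2\,d\mu\Bigr)d\mu\le\frac2\alpha\int_X|\nabla f|^2\,d\mu$$ for every $f\in L^2(\mu)$ for which $|\nabla f|$ is finite at every point of $X$ and belongs to $L^2(\mu)$ (in particular the left-hand side is then finite). For metric probability spaces $\hat X=(X,d_X,\mu)$ and $\hat Y=(Y,d_Y,\nu)$, the $L^2$ transportation distance is $$D_{L^2}(\hat X,\hat Y)=\inf_{\delta,\pi}\Bigl(\iint_{X\times Y}\delta(x,y)^2\,\pi(dx\,dy)\Bigr)^{1/2},$$ where $\delta$ runs over the pseudo metrics $\delta$ with values in $[0,\infty]$ on the disjoint union $X\sqcup Y$ that restrict to $d_X$ on $X$ and to $d_Y$ on $Y$, and $\pi$ over the probability measures on $X\times Y$ with marginals $\mu$ and $\nu$. **Lemma 2.1.** Let $\nu$ be a Radon probability measure on $\ell^2=\ell^2(\mathbb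 N;\mathbb R)$, and for $n\ge1$ let $\nu_n$ be the marginal of $\nu$ for the first $n$ coordinates. Suppose that there is $\alpha>0$ such that $X^n=(\mathbb R^n,\|\cdot\|_{\ell^2},\nu_n)$ satisfies $LSI(\alpha)$ for all $n\ge1$. Then $X^\infty=(\ell^2,\|\cdot\|_{\ell^2},\nu)$ satisfies $LSI(\alpha)$, and $D_{L^2}(X^n,X^\infty)\to0$ as $n\to\infty$. No further assumption on $\nu$ is made; in particular, the lemma covers every $\nu$ that is formally of the shape $e^{-V(x)}\prod_{j}dx_j$ with $V$ continuously differentiable and $\int\|\nabla V\|_{\ell^2}^2\,d\nu<\infty$. -/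

import Mathlib

open MeasureTheory Filter Topology
open scoped ENNReal

noncomputable section

/-- The norm of the gradient `|∇f|(x) = limsup_{y → x, y ≠ x} |f y - f x| / d(y, x)`,
as an extended nonnegative number. -/
def gradNorm {X : Type*} [MetricSpace X] (f : X → ℝ) (x : X) : ℝ≥0∞ :=
  limsup (fun y => ENNReal.ofReal (|f y - f x| / dist y x)) (𝓝[≠] x)

/-- The logarithmic Sobolev inequality `LSI(α)` for `(X, d, μ)`: it is required of every
`f ∈ L²(μ)` whose gradient norm is a (finite) real-valued function that lies in `L²(μ)`.
The negative part of `f² log (f² / ∫ f²)` is always integrable, so that its integrability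
says that the entropy is not `+∞`. -/
def LSI {X : Type*} [MetricSpace X] [MeasurableSpace X] (μ : Measure X) (α : ℝ) : Prop :=
  ∀ f : X → ℝ, MemLp f 2 μ → (∀ x, gradNorm f x ≠ ∞) →
    MemLp (fun x => (gradNorm f x).toReal) 2 μ →
    Integrable (fun x => f x ^ 2 * Real.log (f x ^ 2 / ∫ z, f z ^ 2 ∂μ)) μ ∧
      ∫ x, f x ^ 2 * Real.log (f x ^ 2 / ∫ z, f z ^ 2 ∂μ) ∂μ ≤
        2 / α * ∫ x, (gradNorm f x).toReal ^ 2 ∂μ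

/-- `δ` is a coupling of the metric spaces `X` and `Y`: a pseudo metric with values in `[0, ∞]`
on the disjoint union of `X` and `Y` that restricts to the given metrics. -/
structure IsMetricCoupling {X Y : Type*} [MetricSpace X] [MetricSpace Y]
    (δ : X ⊕ Y → X ⊕ Y → ℝ≥0∞) : Prop where
  self : ∀ z, δ z z = 0
  symm : ∀ z w, δ z w = δ w z
  triangle : ∀ z w v, δ z v ≤ δ z w + δ w v
  left : ∀ x x' : X, δ (Sum.inl x) (Sum.inl x') = edist x x'
  right : ∀ y y' : Y, δ (Sum.inr y) (Sum.inr y') = edist y y'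

/-- `π` is a transportation plan between `μ` and `ν`: its marginals are `μ` and `ν`. -/
def IsTransportPlan {X Y : Type*} [MeasurableSpace X] [MeasurableSpace Y]
    (μ : Measure X) (ν : Measure Y) (π : Measure (X × Y)) : Prop :=
  π.map Prod.fst = μ ∧ π.map Prod.snd = ν

/-- The `L²` transportation distance between `(X, d, μ)` and `(Y, d, ν)`. -/
def DL2 {X Y : Type*} [MetricSpace X] [MeasurableSpace X] [MetricSpace Y] [MeasurableSpace Y]
    (μ : Measure X) (ν : Measure Y) : ℝ≥0∞ :=
  ⨅ (δ : X ⊕ Y → X ⊕ Y → ℝ≥0∞) (_ : IsMetricCoupling δ)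
    (π : Measure (X × Y)) (_ : IsTransportPlan μ ν π),
    (∫⁻ p, δ (Sum.inl p.1) (Sum.inr p.2) ^ 2 ∂π) ^ (1 / 2 : ℝ)

/-- The real Hilbert space `ℓ²(ℕ; ℝ)`. -/
abbrev ellTwo : Type := lp (fun _ : ℕ => ℝ) 2

/-- The first `n` coordinates, as a point of Euclidean space. -/
def firstCoords (n : ℕ) (x : ellTwo) : EuclideanSpace ℝ (Fin n) :=
  WithLp.toLp 2 (fun i : Fin n => x i)

/-- The marginal of `ν` for the first `n` coordinates. -/
def marginal [MeasurableSpace ellTwo] (ν : Measure ellTwo) (n : ℕ) :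
    Measure (EuclideanSpace ℝ (Fin n)) :=
  ν.map (firstCoords n)

end

/-! Let `P n` be the projection of `ℓ²` onto its first `n + 1` coordinates. If the slope of a
bounded `u` is at most a bounded continuous `g`, then the inequality for the marginal, applied to
the restriction of `u`, bounds the entropy of `u ∘ P n` by `2/α ∫ (g ∘ P n)²`. As `n → ∞`, dominated
convergence handles the right side and Fatou the entropy. This is `entropyLE_of_gradNorm_le`.

A general slope is only Borel, so its values at `P n x` say nothing about its value at `x`. The core
is therefore a density in energy, `exists_tendsto_gradNorm_le`. By Vitali–Carathéodory and
tightness, the slope of a bounded `f`, raised by a small `κ`, lies below a lower semicontinuous `h`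
with compact sublevel sets and almost the same `L²` norm. The Lipschitz functions `g_k = lipApprox h
k` lie below `h`, and `u_k` is the largest function between `-M` and `f` with slope at most `g_k`.
If `U = sup u_k` were below `f` somewhere, Ekeland's principle would give an almost minimal point of
`U - f`. Maximality of `u_k` prevents raising it there by a cone, so it must be low at some point of
an annulus where `g_k` is bounded. Compactness gives a limit of such points, contradicting almost
minimality. Truncation then removes the bound on `f`.

For the transport distance, the inequality applied to truncations of `(‖x‖ - r)⁺` gives a finite
second moment. Coupling `x` with its projection then costs the tail of `‖x‖²`, which tends to zero
by dominated convergence. -/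

/-! ### Calculus of the slope. -/

section GradNorm

variable {X Y : Type*} [MetricSpace X] [MetricSpace Y]

theorem gradNorm_le_ofReal_iff {f : X → ℝ} {x : X} {L : ℝ} (hL : 0 ≤ L) :
    gradNorm f x ≤ ENNReal.ofReal L ↔
      ∀ L' > L, ∀ᶠ y in 𝓝 x, |f y - f x| ≤ L' * dist y x := by
  constructor
  · intro h L' hL'
    have hlt : gradNorm f x < ENNReal.ofReal L' :=
      h.trans_lt ((ENNReal.ofReal_lt_ofReal_iff (hL.trans_lt hL')).2 hL')
    have hev := eventually_lt_of_limsup_lt hlt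
    rw [eventually_nhdsWithin_iff] at hev
    filter_upwards [hev] with y hy
    by_cases hyx : y = x
    · simp [hyx]
    · have hd : 0 < dist y x := dist_pos.2 hyx
      have := ENNReal.ofReal_lt_ofReal_iff (hL.trans_lt hL') |>.1 (hy hyx)
      exact ((div_lt_iff₀ hd).1 this).le
  · intro h
    refine ENNReal.le_of_forall_pos_le_add fun ε hε _ => ?_
    have h1 := h (L + ε) (by simpa using hε)
    have h2 : gradNorm f x ≤ ENNReal.ofReal (L + ε) := by
      refine limsup_le_of_le (by isBoundedDefault) ?_
      rw [eventually_nhdsWithin_iff]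
      filter_upwards [h1] with y hy hyx
      exact ENNReal.ofReal_le_ofReal ((div_le_iff₀ (dist_pos.2 hyx)).2 hy)
    have h3 : ENNReal.ofReal (L + ε) = ENNReal.ofReal L + ε := by
      rw [ENNReal.ofReal_add hL ε.coe_nonneg, ENNReal.ofReal_coe_nnreal]
    exact h2.trans_eq h3

theorem gradNorm_eventually_le {f : X → ℝ} {x : X} (h : gradNorm f x ≠ ∞) {L : ℝ}
    (hL : (gradNorm f x).toReal < L) : ∀ᶠ y in 𝓝 x, |f y - f x| ≤ L * dist y x :=
  (gradNorm_le_ofReal_iff ENNReal.toReal_nonneg).1 (ENNReal.ofReal_toReal h).ge L hL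

theorem continuous_of_gradNorm_ne_top {f : X → ℝ} (h : ∀ x, gradNorm f x ≠ ∞) :
    Continuous f := by
  refine continuous_iff_continuousAt.2 fun x => ?_
  have h1 := gradNorm_eventually_le (h x) (lt_add_one _)
  rw [ContinuousAt, tendsto_iff_dist_tendsto_zero]
  refine squeeze_zero' (Eventually.of_forall fun _ => dist_nonneg) h1 ?_
  have : Continuous fun y => ((gradNorm f x).toReal + 1) * dist y x := by fun_prop
  simpa using this.tendsto x

theorem gradNorm_eq_iInf_iSup (f : X → ℝ) (x : X) :
    gradNorm f x = ⨅ n : ℕ, ⨆ y : X, ⨆ _ : y ≠ x ∧ dist y x < 1 / ((n : ℝ) + 1),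
      ENNReal.ofReal (|f y - f x| / dist y x) := by
  have hb : (𝓝[≠] x).HasBasis (fun _ : ℕ => True)
      (fun n => {y | y ≠ x ∧ dist y x < 1 / ((n : ℝ) + 1)}) := by
    have := nhdsWithin_hasBasis (Metric.nhds_basis_ball_inv_nat_succ (x := x)) {x}ᶜ
    convert this using 2 with n
    ext y
    simp [and_comm]
  rw [gradNorm, hb.limsup_eq_iInf_iSup]
  simp

/-- For a fixed competitor `y` and radius, the base points `x` where `y` is admissible with quotient
above `c` form an open set. Each supremum is thus lower semicontinuous, even though it runs over
uncountably many `y`. -/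
theorem measurable_gradNorm [MeasurableSpace X] [BorelSpace X] {f : X → ℝ}
    (hf : Continuous f) : Measurable (gradNorm f) := by
  have : gradNorm f = fun x => ⨅ n : ℕ, ⨆ y : X, ⨆ _ : y ≠ x ∧ dist y x < 1 / ((n : ℝ) + 1),
      ENNReal.ofReal (|f y - f x| / dist y x) := funext (gradNorm_eq_iInf_iSup f)
  rw [this]
  refine Measurable.iInf fun n => LowerSemicontinuous.measurable ?_
  refine lowerSemicontinuous_iff_isOpen_preimage.2 fun c => ?_
  have : (fun x => ⨆ y : X, ⨆ _ : y ≠ x ∧ dist y x < 1 / ((n : ℝ) + 1),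
      ENNReal.ofReal (|f y - f x| / dist y x)) ⁻¹' Set.Ioi c =
      ⋃ y : X, {x | (y ≠ x ∧ dist y x < 1 / ((n : ℝ) + 1)) ∧
        c < ENNReal.ofReal (|f y - f x| / dist y x)} := by
    ext x
    simp only [Set.mem_preimage, Set.mem_Ioi, lt_iSup_iff, Set.mem_iUnion, Set.mem_ofPred_eq,
      exists_prop]
  rw [this]
  refine isOpen_iUnion fun y => isOpen_iff_mem_nhds.2 ?_
  rintro x ⟨⟨h1, h2⟩, h3⟩
  have hd : dist y x ≠ 0 := dist_ne_zero.2 h1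
  have c1 : ContinuousAt (fun z => dist y z) x := by fun_prop
  have c2 : ContinuousAt (fun z => ENNReal.ofReal (|f y - f z| / dist y z)) x :=
    ENNReal.continuous_ofReal.continuousAt.comp
      (ContinuousAt.div (by fun_prop) c1 hd)
  filter_upwards [c1.eventually_ne hd, c1.eventually_lt_const h2, c2.eventually_const_lt h3]
    with z z1 z2 z3
  exact ⟨⟨dist_ne_zero.1 z1, z2⟩, z3⟩

theorem gradNorm_le_of_forall_dist_le {f : X → ℝ} {L : ℝ} (hL : 0 ≤ L) {x : X}
    (h : ∀ y, |f y - f x| ≤ L * dist y x) : gradNorm f x ≤ ENNReal.ofReal L :=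
  (gradNorm_le_ofReal_iff hL).2 fun _ hL' => Eventually.of_forall fun y =>
    (h y).trans (mul_le_mul_of_nonneg_right hL'.le dist_nonneg)

theorem gradNorm_mono {f g : X → ℝ} {x : X} (h : ∀ y, |f y - f x| ≤ |g y - g x|) :
    gradNorm f x ≤ gradNorm g x :=
  limsup_le_limsup (Eventually.of_forall fun y =>
    ENNReal.ofReal_le_ofReal (div_le_div_of_nonneg_right (h y) dist_nonneg))

theorem gradNorm_comp_isometry_le {ι : Y → X} (hι : Isometry ι) (f : X → ℝ) (y : Y) :
    gradNorm (f ∘ ι) y ≤ gradNorm f (ι y) := by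
  have ht : Tendsto ι (𝓝[≠] y) (𝓝[≠] ι y) :=
    tendsto_nhdsWithin_of_tendsto_nhds_of_eventually_within _
      (hι.continuous.continuousAt.tendsto.mono_left nhdsWithin_le_nhds)
      (eventually_nhdsWithin_of_forall fun z hz => hι.injective.ne hz)
  calc gradNorm (f ∘ ι) y
      = limsup (fun x => ENNReal.ofReal (|f x - f (ι y)| / dist x (ι y))) (map ι (𝓝[≠] y)) := by
        rw [gradNorm, limsup, limsup, map_map]
        congr 2
        ext z
        simp [hι.dist_eq]
    _ ≤ gradNorm f (ι y) := limsup_le_limsup_of_le ht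

theorem gradNorm_congr {f g : X → ℝ} {x : X} (h : f =ᶠ[𝓝 x] g) :
    gradNorm f x = gradNorm g x := by
  refine limsup_congr ?_
  filter_upwards [nhdsWithin_le_nhds h] with y hy
  rw [hy, h.eq_of_nhds]

/-- The slope of a maximum is controlled by the slopes of the functions that attain it. -/
theorem gradNorm_max_le {f g : X → ℝ} (hf : Continuous f) (hg : Continuous g) {x : X} {L : ℝ}
    (hL : 0 ≤ L) (h1 : gradNorm f x ≤ ENNReal.ofReal L)
    (h2 : f x ≤ g x → gradNorm g x ≤ ENNReal.ofReal L) :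
    gradNorm (fun y => max (f y) (g y)) x ≤ ENNReal.ofReal L := by
  rcases lt_or_ge (g x) (f x) with h | h
  · rw [gradNorm_congr (g := f)]
    · exact h1
    · filter_upwards [hg.continuousAt.eventually_lt hf.continuousAt h] with y hy
      exact max_eq_left hy.le
  · refine (gradNorm_le_ofReal_iff hL).2 fun L' hL' => ?_
    filter_upwards [(gradNorm_le_ofReal_iff hL).1 h1 L' hL',
      (gradNorm_le_ofReal_iff hL).1 (h2 h) L' hL'] with y hy1 hy2
    exact (abs_max_sub_max_le_max _ _ _ _).trans (max_le hy1 hy2)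

end GradNorm

/-! ### Increments along segments, and Ekeland's principle. -/

/-- A function whose slope is at most `g`, with `g` Lipschitz of constant `K`, has increments
controlled by `g` at one end point. -/
theorem sub_le_of_gradNorm_le {E : Type*} [NormedAddCommGroup E] [NormedSpace ℝ E]
    {v g : E → ℝ} {K : ℝ} (hK : 0 ≤ K) (hg0 : ∀ x, 0 ≤ g x)
    (hg : ∀ x y, g y ≤ g x + K * dist y x)
    (hv : ∀ x, gradNorm v x ≤ ENNReal.ofReal (g x)) (x y : E) :
    v y ≤ v x + (g x + K * dist y x) * dist y x := by
  have hvc : Continuous v := continuous_of_gradNorm_ne_top fun x =>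
    ((hv x).trans_lt ENNReal.ofReal_lt_top).ne
  set C := (g x + K * dist y x) * dist y x with hC
  let γ : ℝ → E := fun t => x + t • (y - x)
  have hγd : ∀ s t, dist (γ s) (γ t) = |s - t| * dist y x := fun s t => by
    simp only [γ]
    rw [dist_add_left, dist_eq_norm, ← sub_smul, norm_smul, Real.norm_eq_abs, dist_eq_norm]
  have hγc : Continuous γ := by fun_prop
  -- One-dimensional comparison of `v` along the segment with an affine function of slope `C`; no
  -- derivative of `v` is needed.
  have hmain := image_le_of_liminf_slope_right_le_deriv_boundary (f := fun t => v (γ t))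
    (a := 0) (b := 1) (B := fun t => v x + C * t) (B' := fun _ => C)
    (hvc.comp hγc).continuousOn (by simp [γ]) (by fun_prop)
    (fun t _ => by
      simpa using (((hasDerivAt_id t).const_mul C).const_add (v x)).hasDerivWithinAt) ?_
  · simpa [γ] using hmain (Set.right_mem_Icc.2 zero_le_one)
  intro t ht r hr
  refine Eventually.frequently ?_
  by_cases hxy : dist y x = 0
  · have hxy' : y = x := dist_eq_zero.1 hxy
    subst hxy'
    have : 0 < r := by simpa [hC] using hr
    filter_upwards with z
    simpa [γ, slope] using this
  have hd : 0 < dist y x := lt_of_le_of_ne dist_nonneg (Ne.symm hxy)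
  have hgt : g (γ t) ≤ g x + K * dist y x := by
    refine (hg x (γ t)).trans ?_
    have h0 : γ 0 = x := by simp [γ]
    have : dist (γ t) x ≤ dist y x := by
      have := hγd t 0
      rw [h0] at this
      rw [this, sub_zero, abs_of_nonneg ht.1]
      nlinarith [ht.2]
    nlinarith
  obtain ⟨r', hr1, hr2⟩ := exists_between hr
  have hlt : g (γ t) < r' / dist y x := by
    rw [lt_div_iff₀ hd]
    exact (mul_le_mul_of_nonneg_right hgt hd.le).trans_lt hr1
  have hev := (gradNorm_le_ofReal_iff (hg0 _)).1 (hv (γ t)) _ hlt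
  have hev' : ∀ᶠ z in 𝓝[>] t, |v (γ z) - v (γ t)| ≤ r' / dist y x * dist (γ z) (γ t) :=
    nhdsWithin_le_nhds (hγc.continuousAt.eventually hev)
  filter_upwards [hev', self_mem_nhdsWithin] with z hz hzt
  have hzt' : 0 < z - t := sub_pos.2 hzt
  rw [hγd, abs_of_pos hzt'] at hz
  rw [slope_def_field, div_lt_iff₀ hzt']
  have h3 : r' / dist y x * ((z - t) * dist y x) = r' * (z - t) := by field_simp
  rw [h3] at hz
  calc v (γ z) - v (γ t) ≤ r' * (z - t) := (le_abs_self _).trans hz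
    _ < r * (z - t) := mul_lt_mul_of_pos_right hr2 hzt'

/-- Ekeland's variational principle. -/
theorem exists_forall_lt_add_mul_dist {X : Type*} [MetricSpace X] [CompleteSpace X] {Ψ : X → ℝ}
    (hΨ : LowerSemicontinuous Ψ) {b : ℝ} (hb : ∀ x, b ≤ Ψ x) {κ : ℝ} (hκ : 0 < κ) (x₀ : X) :
    ∃ x, Ψ x ≤ Ψ x₀ ∧ ∀ y, y ≠ x → Ψ x < Ψ y + κ * dist y x := by
  -- `y ∈ S x` is a transitive relation. Choosing almost minimal successors makes the sets `S (a n)`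
  -- shrink to one point, below which nothing remains.
  let S : X → Set X := fun x => {y | Ψ y + κ * dist y x ≤ Ψ x}
  have hself : ∀ x, x ∈ S x := fun x => by simp [S]
  have htrans : ∀ {x y z}, y ∈ S x → z ∈ S y → z ∈ S x := fun {x y z} hy hz => by
    simp only [S, Set.mem_ofPred_eq] at *
    nlinarith [dist_triangle z y x]
  have hbdd : ∀ x, BddBelow (Ψ '' S x) := fun x => ⟨b, by rintro _ ⟨y, -, rfl⟩; exact hb y⟩
  have hnext : ∀ (n : ℕ) (x : X), ∃ y ∈ S x, ∀ z ∈ S x, Ψ y ≤ Ψ z + (1 / 2) ^ n := fun n x => by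
    obtain ⟨_, ⟨y, hy, rfl⟩, hlt⟩ := exists_lt_of_csInf_lt (Set.Nonempty.image Ψ ⟨x, hself x⟩)
      (lt_add_of_pos_right (sInf (Ψ '' S x)) (by positivity : (0 : ℝ) < (1 / 2) ^ n))
    exact ⟨y, hy, fun z hz => hlt.le.trans
      (add_le_add_left (csInf_le (hbdd x) (Set.mem_image_of_mem _ hz)) _)⟩
  choose next hmem hle using hnext
  let a : ℕ → X := fun n => Nat.rec x₀ (fun n x => next n x) n
  have ha : ∀ n, a (n + 1) = next n (a n) := fun n => rfl
  have hchain : ∀ n m, n ≤ m → a m ∈ S (a n) := fun n m hnm => by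
    induction m, hnm using Nat.le_induction with
    | base => exact hself _
    | succ m _ ih => exact htrans ih (ha m ▸ hmem m (a m))
  have hdist : ∀ n, ∀ z ∈ S (a (n + 1)), dist z (a (n + 1)) ≤ (1 / 2) ^ n / κ := fun n z hz => by
    have h1 := hle n (a n) z (htrans (hchain n (n + 1) n.le_succ) hz)
    rw [← ha] at h1
    simp only [S, Set.mem_ofPred_eq] at hz
    rw [le_div_iff₀ hκ]
    linarith
  have hlim0 : Tendsto (fun n : ℕ => (1 / 2 : ℝ) ^ n / κ) atTop (𝓝 0) := by
    simpa using (tendsto_pow_atTop_nhds_zero_of_lt_one (by norm_num : (0 : ℝ) ≤ 1 / 2)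
      (by norm_num)).div_const κ
  have hcauchy : CauchySeq fun n => a (n + 1) :=
    cauchySeq_of_le_tendsto_0' (fun n => (1 / 2 : ℝ) ^ n / κ)
      (fun n m hnm => by
        rw [dist_comm]
        exact hdist n _ (hchain (n + 1) (m + 1) (by omega))) hlim0
  obtain ⟨x, hx⟩ := cauchySeq_tendsto_of_complete hcauchy
  have hclosed : ∀ z, IsClosed (S z) := fun z => by
    have : LowerSemicontinuous fun y => Ψ y + κ * dist y z :=
      hΨ.add (Continuous.lowerSemicontinuous (by fun_prop))
    exact this.isClosed_preimage (Ψ z)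
  have hxS : ∀ n, x ∈ S (a n) := fun n => (hclosed _).mem_of_tendsto hx
    (eventually_atTop.2 ⟨n, fun m hm => hchain n (m + 1) (by omega)⟩)
  refine ⟨x, ?_, fun y hy => ?_⟩
  · have := hxS 0
    simp only [S, Set.mem_ofPred_eq] at this
    have h0 : a 0 = x₀ := rfl
    rw [h0] at this
    have : 0 ≤ κ * dist x x₀ := by positivity
    linarith
  · by_contra! hcon
    have hyS : y ∈ S x := hcon
    have hlim : Tendsto (fun n => a (n + 1)) atTop (𝓝 y) := by
      rw [tendsto_iff_dist_tendsto_zero]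
      refine squeeze_zero (fun _ => dist_nonneg) (fun n => ?_) hlim0
      rw [dist_comm]
      exact hdist n y (htrans (hxS (n + 1)) hyS)
    exact hy (tendsto_nhds_unique hlim hx)

/-! ### Lipschitz regularization and semicontinuous majorants. -/

section LipschitzApprox

variable {X : Type*} [MetricSpace X]

/-- The Lipschitz regularization `min (k, inf_y (h y + k d(x, y)))` of `h`. -/
noncomputable def lipApprox (h : X → ℝ≥0∞) (k : ℕ) (x : X) : ℝ :=
  (min (k : ℝ≥0∞) (⨅ y, h y + k * edist y x)).toReal

theorem ofReal_lipApprox (h : X → ℝ≥0∞) (k : ℕ) (x : X) :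
    ENNReal.ofReal (lipApprox h k x) = min (k : ℝ≥0∞) (⨅ y, h y + k * edist y x) :=
  ENNReal.ofReal_toReal (ne_top_of_le_ne_top (ENNReal.natCast_ne_top k) (min_le_left _ _))

theorem lipApprox_nonneg (h : X → ℝ≥0∞) (k : ℕ) (x : X) : 0 ≤ lipApprox h k x :=
  ENNReal.toReal_nonneg

theorem lipApprox_le_natCast (h : X → ℝ≥0∞) (k : ℕ) (x : X) : lipApprox h k x ≤ k := by
  have := ENNReal.toReal_mono (ENNReal.natCast_ne_top k) (min_le_left (k : ℝ≥0∞)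
    (⨅ y, h y + k * edist y x))
  simpa [lipApprox] using this

theorem ofReal_lipApprox_le (h : X → ℝ≥0∞) (k : ℕ) (x : X) :
    ENNReal.ofReal (lipApprox h k x) ≤ h x := by
  rw [ofReal_lipApprox]
  exact (min_le_right _ _).trans ((iInf_le _ x).trans (by simp))

theorem lipApprox_mono (h : X → ℝ≥0∞) {j k : ℕ} (hjk : j ≤ k) (x : X) :
    lipApprox h j x ≤ lipApprox h k x := by
  rw [← ENNReal.ofReal_le_ofReal_iff (lipApprox_nonneg _ _ _), ofReal_lipApprox, ofReal_lipApprox]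
  gcongr

theorem lipApprox_le_add (h : X → ℝ≥0∞) (k : ℕ) (x y : X) :
    lipApprox h k y ≤ lipApprox h k x + k * dist y x := by
  have hnn : 0 ≤ lipApprox h k x + k * dist y x :=
    add_nonneg (lipApprox_nonneg _ _ _) (by positivity)
  rw [← ENNReal.ofReal_le_ofReal_iff hnn, ENNReal.ofReal_add (lipApprox_nonneg _ _ _)
    (by positivity), ofReal_lipApprox, ofReal_lipApprox, ENNReal.ofReal_mul (by positivity),
    ENNReal.ofReal_natCast, ← edist_dist, ← min_add_add_right, ENNReal.iInf_add]
  refine min_le_min le_self_add (iInf_mono fun z => ?_)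
  rw [add_assoc, ← mul_add, edist_comm y x]
  gcongr
  exact edist_triangle _ _ _

theorem continuous_lipApprox (h : X → ℝ≥0∞) (k : ℕ) : Continuous (lipApprox h k) := by
  refine (LipschitzWith.of_le_add_mul k fun x y => ?_).continuous
  simpa using lipApprox_le_add h k y x

theorem exists_ball_le_lipApprox {h : X → ℝ≥0∞} (hh : LowerSemicontinuous h) {x : X} {m : ℝ}
    (hm : ENNReal.ofReal m < h x) :
    ∃ ρ > 0, ∃ k₀ : ℕ, ∀ k ≥ k₀, ∀ y, dist y x < ρ → m ≤ lipApprox h k y := by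
  obtain ⟨ρ, hρ, hball⟩ := Metric.eventually_nhds_iff.1 (hh x _ hm)
  -- For `y` within `ρ / 2` of `x`, a competitor `z` either lies in the ball where `h` exceeds `m`,
  -- or is at least `ρ / 2` away from `y` and pays `k * (ρ / 2) ≥ m`.
  refine ⟨ρ / 2, by positivity, max ⌈m⌉₊ ⌈m / (ρ / 2)⌉₊, fun k hk y hy => ?_⟩
  have hk1 : m ≤ k := (Nat.le_ceil m).trans (by exact_mod_cast (le_max_left _ _).trans hk)
  have hk2 : m ≤ k * (ρ / 2) := by
    rw [← div_le_iff₀ (by positivity)]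
    exact (Nat.le_ceil _).trans (by exact_mod_cast (le_max_right _ _).trans hk)
  rw [← ENNReal.ofReal_le_ofReal_iff (lipApprox_nonneg _ _ _), ofReal_lipApprox]
  refine le_min ?_ (le_iInf fun z => ?_)
  · simpa using ENNReal.ofReal_le_ofReal hk1
  · by_cases hz : dist z x < ρ
    · exact (hball hz).le.trans le_self_add
    · refine le_trans ?_ le_add_self
      have : ρ / 2 ≤ dist z y := by linarith [dist_triangle z y x]
      calc ENNReal.ofReal m ≤ ENNReal.ofReal (k * dist z y) :=
            ENNReal.ofReal_le_ofReal (hk2.trans (by gcongr))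
        _ = k * edist z y := by
            rw [ENNReal.ofReal_mul (by positivity), ENNReal.ofReal_natCast, edist_dist]

/-- Below the cap `k` the infimum is in force, and a near-minimizer keeps both summands under `c`.
This carries compactness of the sublevel sets of `h` over to the regularizations, up to a distance
`c / k`. -/
theorem exists_near_of_lipApprox_lt {h : X → ℝ≥0∞} {k : ℕ} {x : X} {c : ℝ} (hck : c ≤ k)
    (hc : lipApprox h k x < c) : ∃ z, h z ≤ ENNReal.ofReal c ∧ k * dist z x ≤ c := by
  have hc0 : 0 < c := (lipApprox_nonneg _ _ _).trans_lt hc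
  have h1 := (ENNReal.ofReal_lt_ofReal_iff hc0).2 hc
  rw [ofReal_lipApprox, min_lt_iff] at h1
  rcases h1 with h1 | h1
  · refine absurd h1 (not_lt.2 ?_)
    simpa using ENNReal.ofReal_le_ofReal hck
  · obtain ⟨z, hz⟩ := iInf_lt_iff.1 h1
    refine ⟨z, le_self_add.trans hz.le, ?_⟩
    rw [← ENNReal.ofReal_le_ofReal_iff hc0.le, ENNReal.ofReal_mul (by positivity),
      ENNReal.ofReal_natCast, ← edist_dist]
    exact le_add_self.trans hz.le

end LipschitzApprox

/-- A lower semicontinuous function with compact sublevel sets that dominates a given square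
integrable function, at little cost. -/
theorem exists_lowerSemicontinuous_isCompact_sublevel {X : Type*} [MetricSpace X]
    [CompleteSpace X] [SecondCountableTopology X] [MeasurableSpace X] [BorelSpace X]
    (μ : Measure X) [IsProbabilityMeasure μ] {G : X → ℝ≥0∞} (hG : Measurable G)
    (hG2 : ∫⁻ x, G x ^ 2 ∂μ ≠ ∞) {ε : ℝ≥0∞} (hε : ε ≠ 0) :
    ∃ κ : ℝ, 0 < κ ∧ ∃ h : X → ℝ≥0∞, LowerSemicontinuous h ∧
      (∀ x, G x + ENNReal.ofReal κ ≤ h x) ∧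
      (∀ c : ℝ, IsCompact {x | h x ≤ ENNReal.ofReal c}) ∧
      ∫⁻ x, h x ^ 2 ∂μ ≤ ∫⁻ x, G x ^ 2 ∂μ + ε := by
  have hε3 : ε / 3 ≠ 0 := by simpa using hε
  -- For `κ ≤ 1`, `(G + κ)² ≤ G² + κ (G² + 2)`, so this bound makes the shift by `κ` cost at most `ε
  -- / 3`.
  obtain ⟨κ, hκ0, hκ⟩ : ∃ κ : NNReal, 0 < κ ∧ (κ : ℝ≥0∞) * (∫⁻ x, G x ^ 2 ∂μ + 2) ≤ ε / 3 ∧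
      κ ≤ 1 := by
    have ht : Tendsto (fun k : NNReal => (k : ℝ≥0∞) * (∫⁻ x, G x ^ 2 ∂μ + 2)) (𝓝[>] 0) (𝓝 0) := by
      have : Tendsto (fun k : NNReal => (k : ℝ≥0∞) * (∫⁻ x, G x ^ 2 ∂μ + 2)) (𝓝 0)
          (𝓝 (((0 : NNReal) : ℝ≥0∞) * (∫⁻ x, G x ^ 2 ∂μ + 2))) :=
        ENNReal.Tendsto.mul_const (ENNReal.continuous_coe.tendsto 0)
          (Or.inr (by finiteness))
      simpa using this.mono_left nhdsWithin_le_nhds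
    obtain ⟨κ, ⟨h1, h2⟩, h3⟩ := ((ht.eventually_lt_const (pos_iff_ne_zero.2 hε3)).and
      (Ioc_mem_nhdsGT (zero_lt_one' NNReal))).and self_mem_nhdsWithin |>.exists
    exact ⟨κ, h3, h1.le, h2.2⟩
  obtain ⟨H₁, hH₁, hH₁c, hH₁i⟩ := exists_le_lowerSemicontinuous_lintegral_ge μ
    (fun x => (G x + κ) ^ 2) ((hG.add_const _).pow_const 2) hε3
  obtain ⟨δ, hδ0, hδ⟩ := ENNReal.exists_pos_sum_of_countable' hε3 ℕ
  have hK : ∀ j, ∃ K : Set X, IsCompact (closure K) ∧ μ Kᶜ < δ j := fun j =>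
    exists_isCompact_closure_measure_compl_lt μ _ (hδ0 j)
  choose K hKc hKμ using hK
  -- `H₂` counts the compact sets that miss the point. Its integral is at most `∑ δ j`, and `H₂ x <
  -- N` forces `x` into one of the first `N` sets.
  let H₂ : X → ℝ≥0∞ := fun x => ∑' j, (closure (K j))ᶜ.indicator (fun _ => 1) x
  have hH₂c : LowerSemicontinuous H₂ := lowerSemicontinuous_tsum fun j =>
    isClosed_closure.isOpen_compl.lowerSemicontinuous_indicator zero_le_one
  have hsq : ∀ x, ((H₁ x + H₂ x) ^ (1 / 2 : ℝ)) ^ 2 = H₁ x + H₂ x := fun x => by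
    rw [← ENNReal.rpow_natCast, ← ENNReal.rpow_mul]
    norm_num
  refine ⟨κ, hκ0, fun x => (H₁ x + H₂ x) ^ (1 / 2 : ℝ), ?_, fun x => ?_, fun c => ?_, ?_⟩
  · exact (ENNReal.continuous_rpow_const (y := 1 / 2)).comp_lowerSemicontinuous (hH₁c.add hH₂c)
      (ENNReal.monotone_rpow_of_nonneg (by norm_num))
  · rw [ENNReal.ofReal_coe_nnreal, ← ENNReal.pow_le_pow_left_iff two_ne_zero, hsq]
    exact (hH₁ x).trans le_self_add
  · obtain ⟨N, hN⟩ := ENNReal.exists_nat_gt (show ENNReal.ofReal c ^ 2 ≠ ∞ by finiteness)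
    refine ((Finset.range N).isCompact_biUnion fun j _ => hKc j).of_isClosed_subset ?_ ?_
    · exact ((ENNReal.continuous_rpow_const (y := 1 / 2)).comp_lowerSemicontinuous
        (hH₁c.add hH₂c) (ENNReal.monotone_rpow_of_nonneg (by norm_num))).isClosed_preimage _
    · intro x hx
      by_contra hcon
      simp only [Set.mem_iUnion, not_exists] at hcon
      have h1 : (N : ℝ≥0∞) ≤ H₂ x := by
        refine le_trans ?_ (ENNReal.sum_le_tsum (Finset.range N))
        rw [Finset.sum_congr rfl fun j hj => Set.indicator_of_mem (hcon j hj) _]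
        simp
      have h2 : H₁ x + H₂ x ≤ ENNReal.ofReal c ^ 2 := by
        rw [← hsq]
        exact pow_le_pow_left' hx 2
      exact absurd (h1.trans (le_add_self.trans h2)) (not_le.2 hN)
  · simp only [hsq]
    have hH₂i : ∫⁻ x, H₂ x ∂μ ≤ ε / 3 := by
      rw [lintegral_tsum fun j => (measurable_const.indicator
        isClosed_closure.isOpen_compl.measurableSet).aemeasurable]
      refine (ENNReal.tsum_le_tsum fun j => ?_).trans hδ.le
      rw [lintegral_indicator isClosed_closure.isOpen_compl.measurableSet]
      simp only [lintegral_const, one_mul, Measure.restrict_apply_univ]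
      exact (measure_mono (Set.compl_subset_compl.2 subset_closure)).trans (hKμ j).le
    have hGi : ∫⁻ x, (G x + κ) ^ 2 ∂μ ≤ ∫⁻ x, G x ^ 2 ∂μ + ε / 3 := by
      calc ∫⁻ x, (G x + κ) ^ 2 ∂μ ≤ ∫⁻ x, G x ^ 2 + (κ * G x ^ 2 + κ * 2) ∂μ := by
            refine lintegral_mono fun x => ?_
            induction hGx : G x with
            | top => simp
            | coe g =>
              have h1 : (κ : ℝ) ≤ 1 := hκ.2
              have h2 : (g + κ) ^ 2 ≤ g ^ 2 + (κ * g ^ 2 + κ * 2) := by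
                rw [← NNReal.coe_le_coe]
                push_cast
                nlinarith [mul_nonneg κ.coe_nonneg (sq_nonneg ((g : ℝ) - 1)),
                  mul_nonneg κ.coe_nonneg (sub_nonneg.2 h1)]
              have h3 := ENNReal.coe_le_coe.2 h2
              push_cast at h3
              exact h3
        _ = ∫⁻ x, G x ^ 2 ∂μ + κ * (∫⁻ x, G x ^ 2 ∂μ + 2) := by
            rw [lintegral_add_left (hG.pow_const 2), lintegral_add_right _ measurable_const,
              lintegral_const_mul _ (hG.pow_const 2), mul_add]
            simp
        _ ≤ _ := by gcongr; exact hκ.1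
    calc ∫⁻ x, H₁ x + H₂ x ∂μ = ∫⁻ x, H₁ x ∂μ + ∫⁻ x, H₂ x ∂μ :=
          lintegral_add_left hH₁c.measurable _
      _ ≤ ((∫⁻ x, G x ^ 2 ∂μ + ε / 3) + ε / 3) + ε / 3 := by
          gcongr
          exact hH₁i.trans (by gcongr)
      _ = _ := by rw [add_assoc, add_assoc, ← add_assoc (ε / 3), ENNReal.add_thirds]

/-! ### Envelopes with prescribed slope. -/

section SlopeEnvelope

variable {E : Type*} [NormedAddCommGroup E]

/-- The functions between `-M` and `f` whose slope is at most `g`. -/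
def slopeMinorants (f g : E → ℝ) (M : ℝ) : Set (E → ℝ) :=
  {v | (∀ x, -M ≤ v x ∧ v x ≤ f x) ∧ ∀ x, gradNorm v x ≤ ENNReal.ofReal (g x)}

/-- The largest function between `-M` and `f` whose slope is at most `g`. -/
noncomputable def slopeEnvelope (f g : E → ℝ) (M : ℝ) (x : E) : ℝ :=
  ⨆ v : slopeMinorants f g M, v.1 x

variable {f g : E → ℝ} {M : ℝ}

theorem const_mem_slopeMinorants (hf : ∀ x, |f x| ≤ M) :
    (fun _ => -M) ∈ slopeMinorants f g M := by
  refine ⟨fun x => ⟨le_rfl, (abs_le.1 (hf x)).1⟩, fun x => ?_⟩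
  refine (gradNorm_le_of_forall_dist_le le_rfl ?_).trans (by simp : ENNReal.ofReal 0 ≤ _)
  simp

theorem bddAbove_slopeMinorants (x : E) :
    BddAbove (Set.range fun v : slopeMinorants f g M => v.1 x) :=
  ⟨f x, by rintro _ ⟨v, rfl⟩; exact (v.2.1 x).2⟩

theorem le_slopeEnvelope {v : E → ℝ} (hv : v ∈ slopeMinorants f g M) (x : E) :
    v x ≤ slopeEnvelope f g M x :=
  le_ciSup (bddAbove_slopeMinorants x) (⟨v, hv⟩ : slopeMinorants f g M)

theorem slopeEnvelope_mono {g' : E → ℝ} (hgg : ∀ x, g x ≤ g' x) (hf : ∀ x, |f x| ≤ M) (x : E) :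
    slopeEnvelope f g M x ≤ slopeEnvelope f g' M x := by
  have hne : Nonempty (slopeMinorants f g M) := ⟨⟨_, const_mem_slopeMinorants hf⟩⟩
  exact ciSup_le fun v => le_slopeEnvelope
    ⟨v.2.1, fun x => (v.2.2 x).trans (ENNReal.ofReal_le_ofReal (hgg x))⟩ x

variable [NormedSpace ℝ E]

/-- The increment bound of `sub_le_of_gradNorm_le` is the same for all minorants, so it survives the
supremum. Used in both directions, with `g` Lipschitz, it returns the slope bound `g x` as `y → x`.
-/
theorem slopeEnvelope_mem {K : ℝ} (hK : 0 ≤ K) (hg0 : ∀ x, 0 ≤ g x)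
    (hg : ∀ x y, g y ≤ g x + K * dist y x) (hf : ∀ x, |f x| ≤ M) :
    slopeEnvelope f g M ∈ slopeMinorants f g M := by
  have hne : Nonempty (slopeMinorants f g M) := ⟨⟨_, const_mem_slopeMinorants hf⟩⟩
  have hinc : ∀ x y, slopeEnvelope f g M y ≤
      slopeEnvelope f g M x + (g x + K * dist y x) * dist y x := fun x y =>
    ciSup_le fun v => (sub_le_of_gradNorm_le hK hg0 hg v.2.2 x y).trans
      (add_le_add_left (le_slopeEnvelope v.2 x) _)
  refine ⟨fun x => ⟨le_slopeEnvelope (const_mem_slopeMinorants hf) x,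
    ciSup_le fun v => (v.2.1 x).2⟩, fun x => ?_⟩
  refine (gradNorm_le_ofReal_iff (hg0 x)).2 fun L hL => ?_
  have hc : Continuous fun y => g x + 2 * K * dist y x := by fun_prop
  have hev : ∀ᶠ y in 𝓝 x, g x + 2 * K * dist y x < L :=
    hc.continuousAt.eventually_lt_const (by simpa using hL)
  filter_upwards [hev] with y hy
  have hd : 0 ≤ dist y x := dist_nonneg
  have h1 := hinc x y
  have h2 := hinc y x
  have h3 := hg x y
  rw [dist_comm x y] at h2
  have hL' : (g x + 2 * K * dist y x) * dist y x ≤ L * dist y x := by gcongr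
  have h4 : g y * dist y x ≤ (g x + K * dist y x) * dist y x := by gcongr
  have h5 : 0 ≤ K * dist y x * dist y x := by positivity
  rw [abs_le]
  constructor <;> nlinarith

/-- Where the envelope `u` lies below `f` it cannot be raised by a cone of slope `m ≤ g`: some
point of an annulus about `x`, at which `g` is not too large, lies below the cone. -/
theorem exists_slopeEnvelope_le {K : ℝ} (hK : 0 ≤ K) (hg0 : ∀ x, 0 ≤ g x)
    (hg : ∀ x y, g y ≤ g x + K * dist y x) (hf : ∀ x, |f x| ≤ M) {x : E} {m r δ : ℝ}
    (hm : 0 ≤ m) (hr : 0 < r) (hδ : 0 < δ)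
    (hfx : ∀ y, dist y x ≤ r → f x - m * dist y x ≤ f y)
    (hgx : ∀ y, dist y x ≤ r → m ≤ g y) (hδf : slopeEnvelope f g M x + δ ≤ f x) :
    ∃ y, r / 2 ≤ dist y x ∧ dist y x ≤ r ∧ g y < m + 2 * (2 * M + 1) / r ∧
      slopeEnvelope f g M y ≤ slopeEnvelope f g M x + δ - m * dist y x := by
  by_contra! hcon
  set u := slopeEnvelope f g M with hu
  have humem : u ∈ slopeMinorants f g M := slopeEnvelope_mem hK hg0 hg hf
  set c := 2 * (2 * M + 1) / r with hc
  have hM : 0 ≤ M := (abs_nonneg _).trans (hf x)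
  have hc0 : 0 ≤ c := by positivity
  have hcr : c * (r / 2) = 2 * M + 1 := by rw [hc]; field_simp
  -- A cone of slope `m` raised by `δ` at its apex, made steeper by `c` beyond radius `r / 2`. Since
  -- `c * (r / 2) = 2 * M + 1`, it is below `-M` beyond radius `r`. On the annulus, `hcon` yields `g
  -- y ≥ m + c` wherever `w` reaches `u`, so `max u w` is admissible and exceeds `u` at `x`.
  let w : E → ℝ := fun y => u x + δ - m * dist y x - c * max (dist y x - r / 2) 0
  have huc : Continuous u := continuous_of_gradNorm_ne_top fun x =>
    ((humem.2 x).trans_lt ENNReal.ofReal_lt_top).ne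
  have hwc : Continuous w := by fun_prop
  have hw_le : ∀ y, w y ≤ u x + δ - m * dist y x := fun y => by
    have : 0 ≤ c * max (dist y x - r / 2) 0 := by positivity
    simp only [w]
    linarith
  have hfar : ∀ y, r < dist y x → w y < -M := fun y hy => by
    have h1 : c * (r / 2) ≤ c * max (dist y x - r / 2) 0 :=
      mul_le_mul_of_nonneg_left (le_max_of_le_left (by linarith)) hc0
    have h2 : 0 ≤ m * dist y x := by positivity
    have h3 := (abs_le.1 (hf x)).2
    simp only [w]
    linarith
  have hvmem : (fun y => max (u y) (w y)) ∈ slopeMinorants f g M := by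
    refine ⟨fun y => ⟨(humem.1 y).1.trans (le_max_left _ _), max_le (humem.1 y).2 ?_⟩,
      fun y => gradNorm_max_le huc hwc (hg0 y) (humem.2 y) fun huw => ?_⟩
    · rcases le_or_gt (dist y x) r with hy | hy
      · linarith [hw_le y, hfx y hy]
      · linarith [hfar y hy, (abs_le.1 (hf y)).1]
    · have hy : dist y x ≤ r := by
        by_contra! hy
        linarith [hfar y hy, (humem.1 y).1]
      rcases lt_or_ge (dist y x) (r / 2) with hy2 | hy2
      · have hcone : w =ᶠ[𝓝 y] fun z => u x + δ - m * dist z x := by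
          have : ∀ᶠ z in 𝓝 y, dist z x < r / 2 :=
            (by fun_prop : Continuous fun z => dist z x).continuousAt.eventually_lt_const hy2
          filter_upwards [this] with z hz
          simp only [w]
          rw [max_eq_right (by linarith)]
          ring
        rw [gradNorm_congr hcone]
        refine (gradNorm_le_of_forall_dist_le hm fun z => ?_).trans
          (ENNReal.ofReal_le_ofReal (hgx y hy))
        have : u x + δ - m * dist z x - (u x + δ - m * dist y x) =
          m * (dist y x - dist z x) := by ring
        rw [this, abs_mul, abs_of_nonneg hm, dist_comm z y]
        gcongr
        exact abs_dist_sub_le y z x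
      · have hgy : m + c ≤ g y := by
          by_contra! hlt
          exact absurd (huw.trans (hw_le y)) (not_le.2 (hcon y hy2 hy hlt))
        refine (gradNorm_le_of_forall_dist_le (add_nonneg hm hc0) fun z => ?_).trans
          (ENNReal.ofReal_le_ofReal hgy)
        have h1 : |dist y x - dist z x| ≤ dist z y := by
          rw [dist_comm z y]
          exact abs_dist_sub_le y z x
        have h2 : |max (dist y x - r / 2) 0 - max (dist z x - r / 2) 0| ≤ dist z y := by
          refine (abs_max_sub_max_le_abs _ _ _).trans ?_
          rwa [sub_sub_sub_cancel_right]
        have : w z - w y = m * (dist y x - dist z x) +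
            c * (max (dist y x - r / 2) 0 - max (dist z x - r / 2) 0) := by
          simp only [w]
          ring
        rw [this, add_mul]
        refine (abs_add_le _ _).trans (add_le_add ?_ ?_)
        · rw [abs_mul, abs_of_nonneg hm]
          gcongr
        · rw [abs_mul, abs_of_nonneg hc0]
          gcongr
  have h1 := le_slopeEnvelope hvmem x
  have h2 : w x = u x + δ := by
    simp only [w, dist_self]
    rw [max_eq_right (by linarith)]
    ring
  have h3 : w x ≤ u x := (le_max_right _ _).trans h1
  linarith

variable [CompleteSpace E]

/-- The envelopes for the Lipschitz regularizations of `h` exhaust `f`, if `h` is a lower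
semicontinuous function with compact sublevel sets that exceeds the slope of `f`. -/
theorem tendsto_slopeEnvelope_lipApprox (hf : ∀ x, |f x| ≤ M) (hgf : ∀ x, gradNorm f x ≠ ∞)
    {κ : ℝ} (hκ : 0 < κ) {h : E → ℝ≥0∞} (hh : LowerSemicontinuous h)
    (hfh : ∀ x, gradNorm f x + ENNReal.ofReal κ ≤ h x)
    (hcpt : ∀ c : ℝ, IsCompact {x | h x ≤ ENNReal.ofReal c}) (x : E) :
    Tendsto (fun k => slopeEnvelope f (lipApprox h k) M x) atTop (𝓝 (f x)) := by
  set u : ℕ → E → ℝ := fun k => slopeEnvelope f (lipApprox h k) M with hu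
  have hmem : ∀ k, u k ∈ slopeMinorants f (lipApprox h k) M := fun k =>
    slopeEnvelope_mem k.cast_nonneg (lipApprox_nonneg h k) (lipApprox_le_add h k) hf
  have hmono : ∀ x, Monotone fun k => u k x := fun x j k hjk =>
    slopeEnvelope_mono (lipApprox_mono h hjk) hf x
  have hbdd : ∀ x, BddAbove (Set.range fun k => u k x) := fun x =>
    ⟨f x, by rintro _ ⟨k, rfl⟩; exact ((hmem k).1 x).2⟩
  have huc : ∀ k, Continuous (u k) := fun k => continuous_of_gradNorm_ne_top fun x =>
    (((hmem k).2 x).trans_lt ENNReal.ofReal_lt_top).ne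
  have hfc : Continuous f := continuous_of_gradNorm_ne_top hgf
  set U : E → ℝ := fun x => ⨆ k, u k x with hU
  have hUf : ∀ x, U x ≤ f x := fun x => ciSup_le fun k => ((hmem k).1 x).2
  have hUM : ∀ x, -M ≤ U x := fun x => ((hmem 0).1 x).1.trans (le_ciSup (hbdd x) 0)
  suffices hfU : ∀ x, f x ≤ U x by
    rw [le_antisymm (hfU x) (hUf x)]
    exact tendsto_atTop_ciSup (hmono x) (hbdd x)
  by_contra! hcon
  obtain ⟨x₀, hx₀⟩ := hcon
  have hlsc : LowerSemicontinuous fun x => U x - f x := by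
    simp only [sub_eq_add_neg]
    exact (lowerSemicontinuous_ciSup hbdd fun k => (huc k).lowerSemicontinuous).add
      hfc.neg.lowerSemicontinuous
  obtain ⟨x, hx, hmin⟩ := exists_forall_lt_add_mul_dist hlsc (b := -M - M)
    (fun x => by linarith [hUM x, (abs_le.1 (hf x)).2]) (half_pos hκ) x₀
  set γ := (gradNorm f x).toReal with hγ
  have hγ0 : 0 ≤ γ := ENNReal.toReal_nonneg
  -- The `3κ/4` is the `κ/4` allowed to the slope of `f` plus the `κ/2` of Ekeland's principle, and
  -- it stays below the margin `κ` of `h`.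
  set m := γ + 3 * κ / 4 with hm
  have hmh : ENNReal.ofReal m < h x := by
    refine lt_of_lt_of_le ?_ (hfh x)
    rw [← ENNReal.ofReal_toReal (hgf x), ← ENNReal.ofReal_add hγ0 hκ.le]
    exact (ENNReal.ofReal_lt_ofReal_iff (by positivity)).2 (by linarith)
  obtain ⟨ρ, hρ, k₀, hk₀⟩ := exists_ball_le_lipApprox hh hmh
  obtain ⟨r₀, hr₀, hfr⟩ := Metric.eventually_nhds_iff.1
    (gradNorm_eventually_le (hgf x) (show γ < γ + κ / 4 by linarith))
  obtain ⟨r, hr, hrlt⟩ := exists_between (lt_min hρ hr₀)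
  have hfx : ∀ y, dist y x ≤ r → f x - (γ + κ / 4) * dist y x ≤ f y := fun y hy => by
    have := (abs_le.1 (hfr (hy.trans_lt (hrlt.trans_le (min_le_right _ _))))).1
    linarith
  set D := f x - U x with hD
  have hD0 : 0 < D := by linarith
  set c := m + 2 * (2 * M + 1) / r with hc
  have hstep : ∀ k ≥ k₀, ∃ y, r / 2 ≤ dist y x ∧ dist y x ≤ r ∧ lipApprox h k y < c ∧
      u k y ≤ u k x + D / (k + 1) - m * dist y x := fun k hk => by
    refine exists_slopeEnvelope_le k.cast_nonneg (lipApprox_nonneg h k) (lipApprox_le_add h k) hf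
      (by positivity) hr (by positivity) (fun y hy => ?_)
      (fun y hy => hk₀ k hk y (hy.trans_lt (hrlt.trans_le (min_le_left _ _)))) ?_
    · refine le_trans ?_ (hfx y hy)
      have : (γ + κ / 4) * dist y x ≤ m * dist y x := by
        gcongr
        linarith
      linarith
    · have h1 : u k x ≤ U x := le_ciSup (hbdd x) k
      have h2 : D / (k + 1) ≤ D := div_le_self hD0.le (by linarith [k.cast_nonneg (α := ℝ)])
      change u k x + _ ≤ _
      linarith
  obtain ⟨N, hN⟩ := exists_nat_ge c
  have hstep' : ∀ k : ℕ, ∃ y z, r / 2 ≤ dist y x ∧ dist y x ≤ r ∧ h z ≤ ENNReal.ofReal c ∧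
      (k : ℝ) * dist z y ≤ c ∧ u k y ≤ U x + D / (k + 1) - m * dist y x := fun k => by
    -- `l ≥ k₀` permits the annulus step, and `l ≥ N ≥ c` keeps the cap of `lipApprox` inactive.
    let l := max k (max k₀ N)
    obtain ⟨y, h1, h2, h3, h4⟩ := hstep l (by simp [l])
    have hNl : (N : ℝ) ≤ l := by exact_mod_cast (le_max_right _ _).trans (le_max_right _ _)
    have hkl : (k : ℝ) ≤ l := by exact_mod_cast le_max_left _ _
    obtain ⟨z, h5, h6⟩ := exists_near_of_lipApprox_lt (hN.trans hNl) h3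
    refine ⟨y, z, h1, h2, h5, le_trans (by gcongr) h6, ?_⟩
    calc u k y ≤ u l y := hmono y (le_max_left _ _)
      _ ≤ u l x + D / (l + 1) - m * dist y x := h4
      _ ≤ U x + D / (k + 1) - m * dist y x := by
          gcongr
          exact le_ciSup (hbdd x) l
  choose y z h1 h2 h3 h4 h5 using hstep'
  obtain ⟨p, -, φ, hφ, hzp⟩ := (hcpt c).tendsto_subseq h3
  have hinv : Tendsto (fun k : ℕ => D / ((k : ℝ) + 1)) atTop (𝓝 0) := by
    simpa [div_eq_mul_inv] using (tendsto_one_div_add_atTop_nhds_zero_nat (𝕜 := ℝ)).const_mul D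
  have hzy : Tendsto (fun k => dist (z k) (y k)) atTop (𝓝 0) := by
    refine squeeze_zero' (Eventually.of_forall fun _ => dist_nonneg) ?_
      (tendsto_const_div_atTop_nhds_zero_nat c)
    filter_upwards [eventually_gt_atTop 0] with k hk
    rw [le_div_iff₀ (by exact_mod_cast hk), mul_comm]
    exact h4 k
  have hyp : Tendsto (fun k => y (φ k)) atTop (𝓝 p) :=
    tendsto_of_tendsto_of_dist hzp (hzy.comp hφ.tendsto_atTop)
  have hdp : Tendsto (fun k => dist (y (φ k)) x) atTop (𝓝 (dist p x)) := hyp.dist tendsto_const_nhds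
  have hp1 : r / 2 ≤ dist p x := ge_of_tendsto' hdp fun k => h1 _
  have hp2 : dist p x ≤ r := le_of_tendsto' hdp fun k => h2 _
  -- For fixed `j`, monotonicity gives `u j ≤ u (φ k)` at the moving point. Continuity of `u j`
  -- allows `k → ∞` before the supremum over `j`.
  have hUp : U p ≤ U x - m * dist p x := ciSup_le fun j => by
    have hR : Tendsto (fun k => U x + D / ((φ k : ℝ) + 1) - m * dist (y (φ k)) x) atTop
        (𝓝 (U x - m * dist p x)) := by
      simpa using ((hinv.comp hφ.tendsto_atTop).const_add (U x)).sub (hdp.const_mul m)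
    refine le_of_tendsto_of_tendsto (((huc j).tendsto p).comp hyp) hR ?_
    filter_upwards [hφ.tendsto_atTop.eventually_ge_atTop j] with k hk
    exact (hmono _ hk).trans (h5 (φ k))
  have hpx : p ≠ x := fun hpx => by
    rw [hpx, dist_self] at hp1
    linarith
  have hlt := hmin p hpx
  have hfp := hfx p hp2
  simp only [hm] at hUp
  linarith

end SlopeEnvelope

/-- Density in energy of functions whose slope is dominated by a bounded continuous function. -/
theorem exists_tendsto_gradNorm_le {E : Type*} [NormedAddCommGroup E] [NormedSpace ℝ E]
    [CompleteSpace E] [SecondCountableTopology E] [MeasurableSpace E] [BorelSpace E]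
    (μ : Measure E) [IsProbabilityMeasure μ] {f : E → ℝ} {M : ℝ} (hf : ∀ x, |f x| ≤ M)
    (hgf : ∀ x, gradNorm f x ≠ ∞) (hf2 : ∫⁻ x, gradNorm f x ^ 2 ∂μ ≠ ∞)
    {ε : ℝ≥0∞} (hε : ε ≠ 0) :
    ∃ (u g : ℕ → E → ℝ), (∀ k x, |u k x| ≤ M) ∧ (∀ k, Continuous (g k)) ∧
      (∀ k x, 0 ≤ g k x ∧ g k x ≤ k) ∧ (∀ k x, gradNorm (u k) x ≤ ENNReal.ofReal (g k x)) ∧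
      (∀ k, ∫⁻ x, ENNReal.ofReal (g k x) ^ 2 ∂μ ≤ ∫⁻ x, gradNorm f x ^ 2 ∂μ + ε) ∧
      ∀ x, Tendsto (fun k => u k x) atTop (𝓝 (f x)) := by
  obtain ⟨κ, hκ, h, hh, hfh, hcpt, hint⟩ := exists_lowerSemicontinuous_isCompact_sublevel μ
    (measurable_gradNorm (continuous_of_gradNorm_ne_top hgf)) hf2 hε
  have hmem : ∀ k : ℕ, slopeEnvelope f (lipApprox h k) M ∈ slopeMinorants f (lipApprox h k) M :=
    fun k => slopeEnvelope_mem k.cast_nonneg (lipApprox_nonneg h k) (lipApprox_le_add h k) hf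
  refine ⟨fun k => slopeEnvelope f (lipApprox h k) M, lipApprox h, fun k x => ?_,
    continuous_lipApprox h, fun k x => ⟨lipApprox_nonneg h k x, lipApprox_le_natCast h k x⟩,
    fun k => (hmem k).2, fun k => ?_, tendsto_slopeEnvelope_lipApprox hf hgf hκ hh hfh hcpt⟩
  · exact abs_le.2 ⟨((hmem k).1 x).1, ((hmem k).1 x).2.trans (abs_le.1 (hf x)).2⟩
  · exact (lintegral_mono fun x => pow_le_pow_left' (ofReal_lipApprox_le h k x) 2).trans hint

/-! ### Entropy: semicontinuity and an `L²` bound. -/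

section Entropy

variable {X : Type*} [MeasurableSpace X] {μ : Measure X}

/-- The entropy of `f²` is finite and at most `C`. -/
def EntropyLE (μ : Measure X) (f : X → ℝ) (C : ℝ) : Prop :=
  Integrable (fun x => f x ^ 2 * Real.log (f x ^ 2 / ∫ z, f z ^ 2 ∂μ)) μ ∧
    ∫ x, f x ^ 2 * Real.log (f x ^ 2 / ∫ z, f z ^ 2 ∂μ) ∂μ ≤ C

theorem sub_le_mul_log_div {t a : ℝ} (ht : 0 ≤ t) (ha : 0 < a) :
    t - a ≤ t * Real.log (t / a) := by
  have h := Real.self_sub_one_le_mul_log (div_nonneg ht ha.le)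
  have h2 := mul_le_mul_of_nonneg_left h ha.le
  have e1 : a * (t / a - 1) = t - a := by field_simp
  have e2 : a * (t / a * Real.log (t / a)) = t * Real.log (t / a) := by field_simp
  rwa [e1, e2] at h2

/-- Lower semicontinuity of the entropy. -/
theorem EntropyLE.of_tendsto [IsProbabilityMeasure μ] {F : ℕ → X → ℝ} {f : X → ℝ}
    (hF : ∀ k, MemLp (F k) 2 μ) (hf : MemLp f 2 μ)
    (hlim : ∀ᵐ x ∂μ, Tendsto (fun k => F k x) atTop (𝓝 (f x)))
    (hnorm : Tendsto (fun k => ∫ x, F k x ^ 2 ∂μ) atTop (𝓝 (∫ x, f x ^ 2 ∂μ)))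
    {C : ℕ → ℝ} {c : ℝ} (hC : Tendsto C atTop (𝓝 c)) (hc : 0 ≤ c)
    (hent : ∀ k, EntropyLE μ (F k) (C k)) : EntropyLE μ f c := by
  set s := ∫ x, f x ^ 2 ∂μ with hs
  have hs0 : 0 ≤ s := integral_nonneg fun x => sq_nonneg _
  rcases hs0.eq_or_lt with hs0 | hs0
  · have hz : (fun x => f x ^ 2 * Real.log (f x ^ 2 / ∫ z, f z ^ 2 ∂μ)) = fun _ => 0 := by
      funext x
      rw [← hs, ← hs0]
      simp
    rw [EntropyLE, hz]
    simpa using hc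
  set a : ℕ → ℝ := fun k => ∫ x, F k x ^ 2 ∂μ with ha
  -- The correction `- t ^ 2 + b` makes the integrand nonnegative, as Fatou needs. It integrates to
  -- zero when `b` is the integral of the square.
  let e : ℝ → ℝ → ℝ := fun t b => t ^ 2 * Real.log (t ^ 2 / b) - t ^ 2 + b
  have he0 : ∀ t b, 0 < b → 0 ≤ e t b := fun t b hb => by
    have := sub_le_mul_log_div (sq_nonneg t) hb
    simp only [e]
    linarith
  have hapos : ∀ᶠ k in atTop, 0 < a k := hnorm.eventually_const_lt hs0
  have hei : ∀ k, Integrable (fun x => e (F k x) (a k)) μ := fun k =>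
    ((hent k).1.sub (hF k).integrable_sq).add (integrable_const _)
  have hev : ∀ k, ∫ x, e (F k x) (a k) ∂μ ≤ C k := fun k => by
    have h1 : ∫ x, e (F k x) (a k) ∂μ =
        ∫ x, F k x ^ 2 * Real.log (F k x ^ 2 / a k) ∂μ - a k + a k := by
      simp only [e]
      have h2 := (hent k).1.sub (hF k).integrable_sq
      rw [Pi.sub_def] at h2
      rw [integral_add h2 (integrable_const _), integral_sub (hent k).1 (hF k).integrable_sq]
      simp [ha]
    rw [h1, sub_add_cancel]
    exact (hent k).2
  have hpt : ∀ᵐ x ∂μ, Tendsto (fun k => e (F k x) (a k)) atTop (𝓝 (e (f x) s)) := by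
    filter_upwards [hlim] with x hx
    have hq : Tendsto (fun k => F k x ^ 2 / a k) atTop (𝓝 (f x ^ 2 / s)) :=
      (hx.pow 2).div hnorm hs0.ne'
    have h1 := hnorm.mul ((Real.continuous_mul_log.tendsto _).comp hq)
    have h2 : s * (f x ^ 2 / s * Real.log (f x ^ 2 / s)) =
        f x ^ 2 * Real.log (f x ^ 2 / s) := by field_simp
    simp only [Function.comp_def, h2] at h1
    have h3 : Tendsto (fun k => F k x ^ 2 * Real.log (F k x ^ 2 / a k)) atTop
        (𝓝 (f x ^ 2 * Real.log (f x ^ 2 / s))) := by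
      refine h1.congr' ?_
      filter_upwards [hapos] with k hk
      have := hk.ne'
      simp only [ha] at this ⊢
      field_simp
    exact (h3.sub (hx.pow 2)).add hnorm
  have hmeas : AEStronglyMeasurable (fun x => e (f x) s) μ :=
    aestronglyMeasurable_of_tendsto_ae atTop (fun k => (hei k).1) hpt
  have hfatou : ∫⁻ x, ENNReal.ofReal (e (f x) s) ∂μ ≤ ENNReal.ofReal c := by
    calc ∫⁻ x, ENNReal.ofReal (e (f x) s) ∂μ
        ≤ ∫⁻ x, liminf (fun k => ENNReal.ofReal (e (F k x) (a k))) atTop ∂μ := by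
          refine lintegral_mono_ae ?_
          filter_upwards [hpt] with x hx
          exact ((ENNReal.continuous_ofReal.tendsto _).comp hx).liminf_eq.ge
      _ ≤ liminf (fun k => ∫⁻ x, ENNReal.ofReal (e (F k x) (a k)) ∂μ) atTop :=
          lintegral_liminf_le' fun k => (hei k).1.aemeasurable.ennreal_ofReal
      _ ≤ liminf (fun k => ENNReal.ofReal (C k)) atTop := by
          refine liminf_le_liminf ?_
          filter_upwards [hapos] with k hk
          rw [← ofReal_integral_eq_lintegral_ofReal (hei k)
            (Eventually.of_forall fun x => he0 _ _ hk)]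
          exact ENNReal.ofReal_le_ofReal (hev k)
      _ = ENNReal.ofReal c := ((ENNReal.continuous_ofReal.tendsto _).comp hC).liminf_eq
  have hint : Integrable (fun x => e (f x) s) μ :=
    ⟨hmeas, (hasFiniteIntegral_iff_ofReal (Eventually.of_forall fun x => he0 _ _ hs0)).2
      (hfatou.trans_lt ENNReal.ofReal_lt_top)⟩
  have heq : (fun x => f x ^ 2 * Real.log (f x ^ 2 / s)) =
      fun x => e (f x) s + f x ^ 2 - s := by
    funext x
    simp only [e]
    ring
  have hle : ∫ x, e (f x) s ∂μ ≤ c := by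
    rw [integral_eq_lintegral_of_nonneg_ae (Eventually.of_forall fun x => he0 _ _ hs0) hmeas]
    exact ENNReal.toReal_le_of_le_ofReal hc hfatou
  rw [EntropyLE, ← hs, heq]
  have hi2 := hint.add hf.integrable_sq
  refine ⟨hi2.sub (integrable_const s), ?_⟩
  rw [integral_sub (f := fun x => e (f x) s + f x ^ 2) hi2 (integrable_const s),
    integral_add hint hf.integrable_sq, ← hs]
  simpa using hle

theorem EntropyLE.of_tendsto_of_bounded [IsProbabilityMeasure μ] {F : ℕ → X → ℝ} {f : X → ℝ}
    (hF : ∀ k, AEStronglyMeasurable (F k) μ) {M : ℝ} (hFM : ∀ k x, |F k x| ≤ M)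
    (hlim : ∀ x, Tendsto (fun k => F k x) atTop (𝓝 (f x)))
    {C : ℕ → ℝ} {c : ℝ} (hC : Tendsto C atTop (𝓝 c)) (hc : 0 ≤ c)
    (hent : ∀ k, EntropyLE μ (F k) (C k)) : EntropyLE μ f c := by
  have hfM : ∀ x, |f x| ≤ M := fun x => le_of_tendsto' (hlim x).abs fun k => hFM k x
  have hfm : AEStronglyMeasurable f μ :=
    aestronglyMeasurable_of_tendsto_ae atTop hF (Eventually.of_forall hlim)
  refine EntropyLE.of_tendsto (fun k => MemLp.of_bound (hF k) M (Eventually.of_forall (hFM k)))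
    (MemLp.of_bound hfm M (Eventually.of_forall hfM)) (Eventually.of_forall hlim) ?_ hC hc hent
  refine tendsto_integral_of_dominated_convergence (fun _ => M ^ 2) (fun k => (hF k).pow 2)
    (integrable_const _) (fun k => Eventually.of_forall fun x => ?_)
    (Eventually.of_forall fun x => (hlim x).pow 2)
  rw [norm_pow, Real.norm_eq_abs]
  exact pow_le_pow_left₀ (abs_nonneg _) (hFM k x) 2

/-- A function that vanishes off a set of small measure is controlled by its entropy. -/
theorem integral_sq_le_of_entropyLE [IsProbabilityMeasure μ] {f : X → ℝ} (hf : MemLp f 2 μ)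
    {C : ℝ} (hC : 0 ≤ C) (hent : EntropyLE μ f C) {A : Set X} (hA : MeasurableSet A)
    (hA1 : μ.real A ≤ Real.exp (-1)) (hfA : ∀ x ∉ A, f x = 0) : ∫ x, f x ^ 2 ∂μ ≤ C := by
  set s := ∫ x, f x ^ 2 ∂μ with hs
  rcases (integral_nonneg fun x => sq_nonneg (f x) : 0 ≤ s).eq_or_lt with hs0 | hs0
  · rwa [hs, ← hs0]
  have hpt : ∀ x, 2 * f x ^ 2 - A.indicator (fun _ => s * Real.exp 1) x ≤
      f x ^ 2 * Real.log (f x ^ 2 / s) := fun x => by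
    by_cases hx : x ∈ A
    · rw [Set.indicator_of_mem hx]
      -- The choice `a = s * e` turns the bound into `2 t - s e ≤ t log (t / s)`. Integrated over
      -- `A`, the loss is at most `s` because `μ(A) ≤ 1/e`.
      have h1 := sub_le_mul_log_div (sq_nonneg (f x)) (mul_pos hs0 (Real.exp_pos 1))
      by_cases h0 : f x = 0
      · rw [h0]
        simp
        positivity
      · rw [← div_div, Real.log_div (by positivity) (Real.exp_pos 1).ne', Real.log_exp] at h1
        linarith
    · rw [Set.indicator_of_notMem hx, hfA x hx]
      simp
  have hi1 : Integrable (A.indicator fun _ => s * Real.exp 1) μ :=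
    (integrable_const _).indicator hA
  have hmono := integral_mono ((hf.integrable_sq.const_mul 2).sub hi1) hent.1 hpt
  have h2 : ∫ x, (2 * f x ^ 2 - A.indicator (fun _ => s * Real.exp 1) x) ∂μ =
      2 * s - μ.real A * (s * Real.exp 1) := by
    rw [integral_sub (hf.integrable_sq.const_mul 2) hi1, integral_const_mul,
      integral_indicator_const _ hA, smul_eq_mul]
  have h3 : μ.real A * (s * Real.exp 1) ≤ s := by
    calc μ.real A * (s * Real.exp 1) ≤ Real.exp (-1) * (s * Real.exp 1) := by gcongr
      _ = s * (Real.exp (-1) * Real.exp 1) := by ring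
      _ = s := by rw [← Real.exp_add]; simp
  have h4 := hmono.trans hent.2
  rw [Pi.sub_def] at h4
  rw [h2] at h4
  linarith

end Entropy

/-! ### Finite-dimensional sections of `ℓ²`. -/

/-- The embedding of Euclidean space as the first coordinates of `ℓ²`. -/
noncomputable def embedCoords (n : ℕ) (ξ : EuclideanSpace ℝ (Fin n)) : ellTwo :=
  ∑ j ∈ Finset.range n, lp.single 2 j (if h : j < n then ξ ⟨j, h⟩ else 0)

theorem norm_embedCoords {n : ℕ} (ξ : EuclideanSpace ℝ (Fin n)) : ‖embedCoords n ξ‖ = ‖ξ‖ := by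
  have h := lp.norm_sum_single (E := fun _ : ℕ => ℝ) (p := 2) (by norm_num)
    (fun j => if h : j < n then ξ ⟨j, h⟩ else 0) (Finset.range n)
  simp only [ENNReal.toReal_ofNat, Real.rpow_ofNat, Finset.sum_range] at h
  rw [← sq_eq_sq₀ (norm_nonneg _) (norm_nonneg _), EuclideanSpace.norm_sq_eq]
  refine Eq.trans ?_ (h.trans ?_)
  · simp [embedCoords, Finset.sum_range]
  · simp

theorem isometry_embedCoords (n : ℕ) : Isometry (embedCoords n) := by
  refine Isometry.of_dist_eq fun ξ η => ?_
  rw [dist_eq_norm, dist_eq_norm, ← norm_embedCoords (ξ - η)]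
  congr 1
  simp only [embedCoords, ← Finset.sum_sub_distrib, ← lp.single_sub]
  refine Finset.sum_congr rfl fun j hj => ?_
  simp [Finset.mem_range.1 hj]

theorem embedCoords_firstCoords (n : ℕ) (x : ellTwo) :
    embedCoords n (firstCoords n x) = ∑ j ∈ Finset.range n, lp.single 2 j (x j) :=
  Finset.sum_congr rfl fun j hj => by simp [firstCoords, Finset.mem_range.1 hj]

theorem tendsto_embedCoords_firstCoords (x : ellTwo) :
    Tendsto (fun n => embedCoords n (firstCoords n x)) atTop (𝓝 x) := by
  simp only [embedCoords_firstCoords]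
  exact (lp.hasSum_single (by norm_num) x).tendsto_sum_nat

theorem dist_embedCoords_firstCoords_le (n : ℕ) (x : ellTwo) :
    dist (embedCoords n (firstCoords n x)) x ≤ ‖x‖ := by
  have h := lp.norm_compl_sum_single (p := 2) (by norm_num) x (Finset.range n)
  simp only [ENNReal.toReal_ofNat, Real.rpow_ofNat] at h
  rw [dist_comm, dist_eq_norm, embedCoords_firstCoords,
    ← sq_le_sq₀ (norm_nonneg _) (norm_nonneg _), h]
  exact sub_le_self _ (Finset.sum_nonneg fun _ _ => sq_nonneg _)

theorem continuous_firstCoords (n : ℕ) : Continuous (firstCoords n) :=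
  (PiLp.continuous_toLp 2 _).comp (continuous_pi fun i =>
    (lp.evalCLM (𝕜 := ℝ) (fun _ : ℕ => ℝ) 2 (i : ℕ)).continuous)

instance secondCountableTopology_ellTwo : SecondCountableTopology ellTwo := by
  have hsep : TopologicalSpace.IsSeparable (closure (⋃ n, Set.range (embedCoords n))) :=
    (TopologicalSpace.IsSeparable.iUnion fun n =>
      TopologicalSpace.isSeparable_range (isometry_embedCoords n).continuous).closure
  have huniv : closure (⋃ n, Set.range (embedCoords n)) = Set.univ :=
    Set.eq_univ_of_forall fun x => mem_closure_of_tendsto (tendsto_embedCoords_firstCoords x)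
      (Eventually.of_forall fun n => Set.mem_iUnion.2 ⟨n, Set.mem_range_self _⟩)
  rw [huniv, TopologicalSpace.isSeparable_univ_iff] at hsep
  exact UniformSpace.secondCountable_of_separable ellTwo

theorem ofReal_integral_toReal_sq {X : Type*} [MeasurableSpace X] {μ : Measure X} {G : X → ℝ≥0∞}
    (hG : ∀ x, G x ≠ ∞) (hG2 : MemLp (fun x => (G x).toReal) 2 μ) :
    ENNReal.ofReal (∫ x, (G x).toReal ^ 2 ∂μ) = ∫⁻ x, G x ^ 2 ∂μ := by
  rw [ofReal_integral_eq_lintegral_ofReal hG2.integrable_sq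
    (Eventually.of_forall fun x => sq_nonneg _)]
  refine lintegral_congr fun x => ?_
  rw [ENNReal.ofReal_pow ENNReal.toReal_nonneg, ENNReal.ofReal_toReal (hG x)]

/-! ### The logarithmic Sobolev inequality on `ℓ²`. -/

section LogSobolev

variable [MeasurableSpace ellTwo] [BorelSpace ellTwo] {ν : Measure ellTwo}
  [IsProbabilityMeasure ν] {α : ℝ}

/-- The logarithmic Sobolev inequality for functions with continuous control of the slope. -/
theorem entropyLE_of_gradNorm_le (hα : 0 < α)
    (hLSI : ∀ n : ℕ, 1 ≤ n → LSI (marginal ν n) α) {u g : ellTwo → ℝ} {M B : ℝ}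
    (hu : ∀ x, |u x| ≤ M) (hg : Continuous g) (hg0 : ∀ x, 0 ≤ g x) (hgB : ∀ x, g x ≤ B)
    (hug : ∀ x, gradNorm u x ≤ ENNReal.ofReal (g x)) :
    EntropyLE ν u (2 / α * ∫ x, g x ^ 2 ∂ν) := by
  have huc : Continuous u := continuous_of_gradNorm_ne_top fun x =>
    ((hug x).trans_lt ENNReal.ofReal_lt_top).ne
  let P : ℕ → ellTwo → ellTwo := fun n x => embedCoords (n + 1) (firstCoords (n + 1) x)
  have hPc : ∀ n, Continuous (P n) := fun n =>
    (isometry_embedCoords _).continuous.comp (continuous_firstCoords _)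
  have hP : ∀ x, Tendsto (fun n => P n x) atTop (𝓝 x) := fun x =>
    (tendsto_add_atTop_iff_nat 1).2 (tendsto_embedCoords_firstCoords x)
  have hstep : ∀ n, EntropyLE ν (fun x => u (P n x)) (2 / α * ∫ x, g (P n x) ^ 2 ∂ν) := fun n => by
    have hfc := (continuous_firstCoords (n + 1)).measurable.aemeasurable (μ := ν)
    have hprob : IsProbabilityMeasure (marginal ν (n + 1)) := Measure.isProbabilityMeasure_map hfc
    have hec := (isometry_embedCoords (n + 1)).continuous
    set v := u ∘ embedCoords (n + 1) with hv
    have hvc : Continuous v := huc.comp hec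
    have hvg : ∀ ξ, gradNorm v ξ ≤ ENNReal.ofReal (g (embedCoords (n + 1) ξ)) := fun ξ =>
      (gradNorm_comp_isometry_le (isometry_embedCoords _) u ξ).trans (hug _)
    have hvg' : ∀ ξ, (gradNorm v ξ).toReal ≤ g (embedCoords (n + 1) ξ) := fun ξ =>
      ENNReal.toReal_le_of_le_ofReal (hg0 _) (hvg ξ)
    have hvm : MemLp (fun ξ => (gradNorm v ξ).toReal) 2 (marginal ν (n + 1)) :=
      MemLp.of_bound (measurable_gradNorm hvc).ennreal_toReal.aestronglyMeasurable B
        (Eventually.of_forall fun ξ => by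
          rw [Real.norm_of_nonneg ENNReal.toReal_nonneg]
          exact (hvg' ξ).trans (hgB _))
    have hgm : MemLp (fun ξ => g (embedCoords (n + 1) ξ)) 2 (marginal ν (n + 1)) :=
      MemLp.of_bound (hg.comp hec).aestronglyMeasurable B
        (Eventually.of_forall fun ξ => by
          rw [Real.norm_of_nonneg (hg0 _)]
          exact hgB _)
    have hmain := hLSI (n + 1) (by omega) v
      (MemLp.of_bound hvc.aestronglyMeasurable M (Eventually.of_forall fun ξ => hu _))
      (fun ξ => ((hvg ξ).trans_lt ENNReal.ofReal_lt_top).ne) hvm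
    have hsq : ∫ ξ, v ξ ^ 2 ∂(marginal ν (n + 1)) = ∫ x, u (P n x) ^ 2 ∂ν :=
      integral_map hfc (hvc.pow 2).aestronglyMeasurable
    rw [hsq] at hmain
    have hentm : AEStronglyMeasurable
        (fun ξ => v ξ ^ 2 * Real.log (v ξ ^ 2 / ∫ x, u (P n x) ^ 2 ∂ν)) (marginal ν (n + 1)) :=
      hmain.1.1
    refine ⟨(integrable_map_measure hentm hfc).1 hmain.1, ?_⟩
    have h1 := integral_map hfc hentm
    refine h1.symm.trans_le (hmain.2.trans ?_)
    have h2 : ∫ ξ, g (embedCoords (n + 1) ξ) ^ 2 ∂(marginal ν (n + 1)) =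
        ∫ x, g (P n x) ^ 2 ∂ν :=
      integral_map hfc ((hg.comp hec).pow 2).aestronglyMeasurable
    rw [← h2]
    refine mul_le_mul_of_nonneg_left ?_ (by positivity)
    exact integral_mono hvm.integrable_sq hgm.integrable_sq fun ξ =>
      pow_le_pow_left₀ ENNReal.toReal_nonneg (hvg' ξ) 2
  refine EntropyLE.of_tendsto_of_bounded
    (fun n => (huc.comp (hPc n)).aestronglyMeasurable) (fun n x => hu _)
    (fun x => (huc.tendsto x).comp (hP x)) (Tendsto.const_mul _ ?_)
    (mul_nonneg (by positivity) (integral_nonneg fun x => sq_nonneg _)) hstep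
  refine tendsto_integral_of_dominated_convergence (fun _ => B ^ 2)
    (fun n => ((hg.comp (hPc n)).pow 2).aestronglyMeasurable) (integrable_const _)
    (fun n => Eventually.of_forall fun x => ?_)
    (Eventually.of_forall fun x => ((hg.tendsto x).comp (hP x)).pow 2)
  rw [norm_pow, Real.norm_of_nonneg (hg0 _)]
  exact pow_le_pow_left₀ (hg0 _) (hgB _) 2

/-- The logarithmic Sobolev inequality for bounded functions. -/
theorem entropyLE_of_bounded (hα : 0 < α)
    (hLSI : ∀ n : ℕ, 1 ≤ n → LSI (marginal ν n) α) {f : ellTwo → ℝ} {M : ℝ}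
    (hf : ∀ x, |f x| ≤ M) (hgf : ∀ x, gradNorm f x ≠ ∞)
    (hf2 : MemLp (fun x => (gradNorm f x).toReal) 2 ν) :
    EntropyLE ν f (2 / α * ∫ x, (gradNorm f x).toReal ^ 2 ∂ν) := by
  set I := ∫ x, (gradNorm f x).toReal ^ 2 ∂ν with hI
  have hI0 : 0 ≤ I := integral_nonneg fun x => sq_nonneg _
  have hlint := ofReal_integral_toReal_sq hgf hf2
  have hε : ∀ ε : ℝ, 0 < ε → EntropyLE ν f (2 / α * (I + ε)) := fun ε hε => by
    obtain ⟨u, g, hu, hgc, hg0, hug, hint, hlim⟩ := exists_tendsto_gradNorm_le ν hf hgf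
      (hlint ▸ ENNReal.ofReal_ne_top) (ENNReal.ofReal_pos.2 hε).ne'
    have hgI : ∀ k, ∫ x, g k x ^ 2 ∂ν ≤ I + ε := fun k => by
      rw [integral_eq_lintegral_of_nonneg_ae (Eventually.of_forall fun x => sq_nonneg _)
        ((hgc k).pow 2).aestronglyMeasurable]
      refine ENNReal.toReal_le_of_le_ofReal (by positivity) ?_
      rw [ENNReal.ofReal_add hI0 hε.le, hlint]
      refine le_trans (lintegral_mono fun x => ?_) (hint k)
      rw [ENNReal.ofReal_pow (hg0 k x).1]
    refine EntropyLE.of_tendsto_of_bounded (fun k => ?_) hu hlim tendsto_const_nhds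
      (by positivity) fun k => ?_
    · exact (continuous_of_gradNorm_ne_top fun x =>
        ((hug k x).trans_lt ENNReal.ofReal_lt_top).ne).aestronglyMeasurable
    · have h := entropyLE_of_gradNorm_le hα hLSI (hu k) (hgc k) (fun x => (hg0 k x).1)
        (fun x => (hg0 k x).2) (hug k)
      exact ⟨h.1, h.2.trans (mul_le_mul_of_nonneg_left (hgI k) (by positivity))⟩
  refine ⟨(hε 1 one_pos).1, le_of_forall_pos_le_add fun ε h => ?_⟩
  have h1 := (hε (α / 2 * ε) (by positivity)).2
  have h2 : 2 / α * (I + α / 2 * ε) = 2 / α * I + ε := by field_simp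
  rwa [h2] at h1

/-- Truncation at height `k` does not increase the slope, so the bounded case applies and the
entropy passes to the limit. -/
theorem LSI.of_marginals (hα : 0 < α) (hLSI : ∀ n : ℕ, 1 ≤ n → LSI (marginal ν n) α) :
    LSI ν α := by
  intro f hf hgf hf2
  let F : ℕ → ellTwo → ℝ := fun k x => max (min (f x) k) (-k)
  have hfc : Continuous f := continuous_of_gradNorm_ne_top hgf
  have hFc : ∀ k, Continuous (F k) := fun k => by fun_prop
  have hFf : ∀ k x, gradNorm (F k) x ≤ gradNorm f x := fun k x =>
    gradNorm_mono fun y => (abs_max_sub_max_le_abs _ _ _).trans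
      ((abs_min_sub_min_le_max _ _ _ _).trans (by simp))
  have hFk : ∀ k x, |F k x| ≤ k := fun k x => abs_le.2 ⟨le_max_right _ _,
    max_le (min_le_right _ _) (by linarith [k.cast_nonneg (α := ℝ)])⟩
  have hFle : ∀ k x, |F k x| ≤ |f x| := fun k x => by
    have hk : (0 : ℝ) ≤ k := k.cast_nonneg
    rw [abs_le]
    constructor
    · exact le_max_of_le_left (le_min (neg_abs_le _) (by linarith [abs_nonneg (f x)]))
    · exact max_le ((min_le_left _ _).trans (le_abs_self _)) (by linarith [abs_nonneg (f x)])
  have hgF : ∀ k x, gradNorm (F k) x ≠ ∞ := fun k x => ne_top_of_le_ne_top (hgf x) (hFf k x)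
  have htoReal : ∀ k x, (gradNorm (F k) x).toReal ≤ (gradNorm f x).toReal := fun k x =>
    ENNReal.toReal_mono (hgf x) (hFf k x)
  have hF2 : ∀ k, MemLp (fun x => (gradNorm (F k) x).toReal) 2 ν := fun k =>
    hf2.mono (measurable_gradNorm (hFc k)).ennreal_toReal.aestronglyMeasurable
      (Eventually.of_forall fun x => by
        rw [Real.norm_of_nonneg ENNReal.toReal_nonneg, Real.norm_of_nonneg ENNReal.toReal_nonneg]
        exact htoReal k x)
  have hlim : ∀ x, Tendsto (fun k => F k x) atTop (𝓝 (f x)) := fun x => by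
    obtain ⟨N, hN⟩ := exists_nat_ge |f x|
    refine tendsto_const_nhds.congr' ?_
    filter_upwards [eventually_ge_atTop N] with k hk
    have h1 : |f x| ≤ k := hN.trans (by exact_mod_cast hk)
    simp only [F]
    rw [min_eq_left (abs_le.1 h1).2, max_eq_left (abs_le.1 h1).1]
  refine EntropyLE.of_tendsto (F := F)
    (fun k => hf.mono (hFc k).aestronglyMeasurable (Eventually.of_forall (hFle k))) hf
    (Eventually.of_forall hlim) ?_ tendsto_const_nhds
    (mul_nonneg (by positivity) (integral_nonneg fun x => sq_nonneg _)) fun k => ?_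
  · refine tendsto_integral_of_dominated_convergence (fun x => f x ^ 2)
      (fun k => ((hFc k).pow 2).aestronglyMeasurable) hf.integrable_sq
      (fun k => Eventually.of_forall fun x => ?_)
      (Eventually.of_forall fun x => (hlim x).pow 2)
    rw [norm_pow, Real.norm_eq_abs, ← sq_abs (f x)]
    exact pow_le_pow_left₀ (abs_nonneg _) (hFle k x) 2
  · have h := entropyLE_of_bounded hα hLSI (hFk k) (hgF k) (hF2 k)
    refine ⟨h.1, h.2.trans (mul_le_mul_of_nonneg_left ?_ (by positivity))⟩
    exact integral_mono (hF2 k).integrable_sq hf2.integrable_sq fun x =>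
      pow_le_pow_left₀ ENNReal.toReal_nonneg (htoReal k x) 2

end LogSobolev

/-! ### Second moments and transport. -/

/-- A logarithmic Sobolev inequality implies finite second moments. -/
theorem LSI.lintegral_enorm_sq_ne_top {E : Type*} [NormedAddCommGroup E] [MeasurableSpace E]
    [BorelSpace E] {μ : Measure E} [IsProbabilityMeasure μ] {α : ℝ} (hα : 0 < α)
    (hμ : LSI μ α) : ∫⁻ x, ‖x‖ₑ ^ 2 ∂μ ≠ ∞ := by
  obtain ⟨r, hr⟩ : ∃ r : ℕ, μ.real {x | (r : ℝ) < ‖x‖} ≤ Real.exp (-1) := by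
    have hmeas : ∀ n : ℕ, MeasurableSet {x : E | (n : ℝ) < ‖x‖} := fun n =>
      measurableSet_lt measurable_const measurable_norm
    have ht := tendsto_measure_iInter_atTop (μ := μ) (s := fun n : ℕ => {x : E | (n : ℝ) < ‖x‖})
      (fun n => (hmeas n).nullMeasurableSet)
      (fun m n hmn x (hx : (n : ℝ) < ‖x‖) => lt_of_le_of_lt (by exact_mod_cast hmn) hx)
      ⟨0, measure_ne_top _ _⟩
    have hempty : ⋂ n : ℕ, {x : E | (n : ℝ) < ‖x‖} = ∅ := by
      refine Set.eq_empty_of_forall_notMem fun x hx => ?_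
      obtain ⟨n, hn⟩ := exists_nat_ge ‖x‖
      exact absurd (Set.mem_iInter.1 hx n) (not_lt.2 hn)
    rw [hempty, measure_empty] at ht
    obtain ⟨r, hr⟩ := (ht.eventually_lt_const
      (ENNReal.ofReal_pos.2 (Real.exp_pos (-1)))).exists
    exact ⟨r, ENNReal.toReal_le_of_le_ofReal (Real.exp_pos _).le hr.le⟩
  -- A bounded 1-Lipschitz function vanishing on the ball of radius `r`, whose complement has
  -- measure at most `1/e`. Its entropy therefore controls its `L²` norm uniformly in `k`.
  let q : ℕ → E → ℝ := fun k x => min (max (‖x‖ - r) 0) k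
  have hqc : ∀ k, Continuous (q k) := fun k => by fun_prop
  have hq0 : ∀ k x, 0 ≤ q k x := fun k x => le_min (le_max_right _ _) k.cast_nonneg
  have hqg : ∀ k x, gradNorm (q k) x ≤ ENNReal.ofReal 1 := fun k x =>
    gradNorm_le_of_forall_dist_le zero_le_one fun y => by
      have h1 : |max (‖y‖ - r) 0 - max (‖x‖ - r) 0| ≤ dist y x := by
        refine (abs_max_sub_max_le_abs _ _ _).trans ?_
        rw [sub_sub_sub_cancel_right, dist_eq_norm]
        exact abs_norm_sub_norm_le y x
      rw [one_mul]
      exact (abs_min_sub_min_le_max _ _ _ _).trans (max_le h1 (by simp))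
  have hqg' : ∀ k x, (gradNorm (q k) x).toReal ≤ 1 := fun k x =>
    ENNReal.toReal_le_of_le_ofReal zero_le_one (hqg k x)
  have hqm : ∀ k, MemLp (q k) 2 μ := fun k =>
    MemLp.of_bound (hqc k).measurable.aestronglyMeasurable k (Eventually.of_forall fun x => by
      rw [Real.norm_of_nonneg (hq0 k x)]
      exact min_le_right _ _)
  have hgm : ∀ k, MemLp (fun x => (gradNorm (q k) x).toReal) 2 μ := fun k =>
    MemLp.of_bound (measurable_gradNorm (hqc k)).ennreal_toReal.aestronglyMeasurable 1
      (Eventually.of_forall fun x => by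
        rw [Real.norm_of_nonneg ENNReal.toReal_nonneg]
        exact hqg' k x)
  have hbound : ∀ k, ∫ x, q k x ^ 2 ∂μ ≤ 2 / α := fun k => by
    have h := hμ (q k) (hqm k) (fun x => ((hqg k x).trans_lt ENNReal.ofReal_lt_top).ne) (hgm k)
    have hle : ∫ x, (gradNorm (q k) x).toReal ^ 2 ∂μ ≤ 1 := by
      calc ∫ x, (gradNorm (q k) x).toReal ^ 2 ∂μ ≤ ∫ _, (1 : ℝ) ∂μ :=
            integral_mono (hgm k).integrable_sq (integrable_const _) fun x =>
              pow_le_one₀ ENNReal.toReal_nonneg (hqg' k x)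
        _ = 1 := by simp
    refine integral_sq_le_of_entropyLE (hqm k) (by positivity)
      ⟨h.1, h.2.trans (mul_le_of_le_one_right (by positivity) hle)⟩
      (measurableSet_lt measurable_const measurable_norm) hr fun x hx => ?_
    have hx' : ‖x‖ ≤ r := not_lt.1 hx
    simp only [q]
    rw [max_eq_right (by linarith), min_eq_left k.cast_nonneg]
  have hfatou : ∫⁻ x, ENNReal.ofReal (max (‖x‖ - r) 0 ^ 2) ∂μ ≤ ENNReal.ofReal (2 / α) := by
    calc ∫⁻ x, ENNReal.ofReal (max (‖x‖ - r) 0 ^ 2) ∂μ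
        ≤ ∫⁻ x, liminf (fun k => ENNReal.ofReal (q k x ^ 2)) atTop ∂μ := by
          refine lintegral_mono fun x => le_of_eq ?_
          refine (Tendsto.liminf_eq ?_).symm
          obtain ⟨N, hN⟩ := exists_nat_ge (max (‖x‖ - r) 0)
          refine tendsto_const_nhds.congr' ?_
          filter_upwards [eventually_ge_atTop N] with k hk
          simp only [q]
          rw [min_eq_left (hN.trans (by exact_mod_cast hk))]
      _ ≤ liminf (fun k => ∫⁻ x, ENNReal.ofReal (q k x ^ 2) ∂μ) atTop :=
          lintegral_liminf_le fun k => ((hqc k).measurable.pow_const 2).ennreal_ofReal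
      _ ≤ liminf (fun _ => ENNReal.ofReal (2 / α)) atTop := by
          refine liminf_le_liminf (Eventually.of_forall fun k => ?_)
          rw [← ofReal_integral_eq_lintegral_ofReal (hqm k).integrable_sq
            (Eventually.of_forall fun x => sq_nonneg _)]
          exact ENNReal.ofReal_le_ofReal (hbound k)
      _ = ENNReal.ofReal (2 / α) := by simp
  refine ne_top_of_le_ne_top (b := ENNReal.ofReal (2 * r ^ 2) + 2 * ENNReal.ofReal (2 / α))
    (by finiteness) ?_
  calc ∫⁻ x, ‖x‖ₑ ^ 2 ∂μ
      ≤ ∫⁻ x, ENNReal.ofReal (2 * r ^ 2) + 2 * ENNReal.ofReal (max (‖x‖ - r) 0 ^ 2) ∂μ := by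
        refine lintegral_mono fun x => ?_
        rw [← ofReal_norm, ← ENNReal.ofReal_pow (norm_nonneg _),
          ← ENNReal.ofReal_ofNat 2, ← ENNReal.ofReal_mul zero_le_two,
          ← ENNReal.ofReal_add (by positivity) (by positivity)]
        refine ENNReal.ofReal_le_ofReal ?_
        have h1 : ‖x‖ ≤ r + max (‖x‖ - r) 0 := by linarith [le_max_left (‖x‖ - r) 0]
        nlinarith [norm_nonneg x, sq_nonneg (r - max (‖x‖ - (r : ℝ)) 0)]
    _ = ENNReal.ofReal (2 * r ^ 2) + 2 * ∫⁻ x, ENNReal.ofReal (max (‖x‖ - r) 0 ^ 2) ∂μ := by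
        rw [lintegral_add_left measurable_const, lintegral_const_mul' _ _ (by finiteness)]
        simp
    _ ≤ _ := by gcongr

theorem isMetricCoupling_of_isometry {X Y : Type*} [MetricSpace X] [MetricSpace Y] {ι : X → Y}
    (hι : Isometry ι) :
    IsMetricCoupling fun z w : X ⊕ Y => edist (Sum.elim ι id z) (Sum.elim ι id w) where
  self _ := edist_self _
  symm _ _ := edist_comm _ _
  triangle _ _ _ := edist_triangle _ _ _
  left _ _ := hι _ _
  right _ _ := rfl

section Transport

variable [MeasurableSpace ellTwo] [BorelSpace ellTwo]

/-- The competitor pulls the metric of `ℓ²` back along the isometric embedding and transports by the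
law of `(firstCoords n x, x)`. -/
theorem DL2_marginal_le (ν : Measure ellTwo) (n : ℕ) :
    DL2 (marginal ν n) ν ≤
      (∫⁻ x, edist (embedCoords n (firstCoords n x)) x ^ 2 ∂ν) ^ (1 / 2 : ℝ) := by
  have hfc := (continuous_firstCoords n).measurable
  have hpair : Measurable fun x => (firstCoords n x, x) := hfc.prodMk measurable_id
  have hplan : IsTransportPlan (marginal ν n) ν (ν.map fun x => (firstCoords n x, x)) := by
    refine ⟨?_, ?_⟩
    · rw [Measure.map_map measurable_fst hpair]
      rfl
    · rw [Measure.map_map measurable_snd hpair]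
      exact Measure.map_id
  refine (iInf₂_le _ (isMetricCoupling_of_isometry (isometry_embedCoords n))).trans
    ((iInf₂_le _ hplan).trans_eq ?_)
  rw [lintegral_map _ hpair]
  · rfl
  · exact (((isometry_embedCoords n).continuous.measurable.comp measurable_fst).edist
      measurable_snd).pow_const 2

theorem tendsto_DL2_marginal {ν : Measure ellTwo} (hν : ∫⁻ x, ‖x‖ₑ ^ 2 ∂ν ≠ ∞) :
    Tendsto (fun n : ℕ => DL2 (marginal ν n) ν) atTop (𝓝 0) := by
  have hcost : Tendsto (fun n => ∫⁻ x, edist (embedCoords n (firstCoords n x)) x ^ 2 ∂ν) atTop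
      (𝓝 (∫⁻ _, 0 ∂ν)) := by
    refine tendsto_lintegral_of_dominated_convergence (fun x => ‖x‖ₑ ^ 2) (fun n => ?_)
      (fun n => Eventually.of_forall fun x => ?_) hν (Eventually.of_forall fun x => ?_)
    · exact ((((isometry_embedCoords n).continuous.comp
        (continuous_firstCoords n)).measurable).edist measurable_id).pow_const 2
    · refine pow_le_pow_left' ?_ 2
      rw [edist_dist, ← ofReal_norm]
      exact ENNReal.ofReal_le_ofReal (dist_embedCoords_firstCoords_le n x)
    · have h := tendsto_iff_edist_tendsto_0.1 (tendsto_embedCoords_firstCoords x)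
      simpa using ENNReal.Tendsto.pow (n := 2) h
  have hsqrt := (ENNReal.continuous_rpow_const (y := 1 / 2)).tendsto (∫⁻ _, 0 ∂ν) |>.comp hcost
  refine tendsto_of_tendsto_of_tendsto_of_le_of_le tendsto_const_nhds ?_ (fun _ => zero_le)
    (DL2_marginal_le ν)
  simpa [Function.comp_def] using hsqrt

end Transport

theorem lemma2p1 [MeasurableSpace ellTwo] [BorelSpace ellTwo]
    (ν : Measure ellTwo) [IsProbabilityMeasure ν]
    (α : ℝ) (hα : 0 < α)
    (hLSI : ∀ n : ℕ, 1 ≤ n → LSI (marginal ν n) α) :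
    LSI ν α ∧ Tendsto (fun n : ℕ => DL2 (marginal ν n) ν) atTop (𝓝 0) := by
  have hν : LSI ν α := LSI.of_marginals hα hLSI
  exact ⟨hν, tendsto_DL2_marginal (hν.lintegral_enorm_sq_ne_top hα)⟩
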